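/- **Setting.** Let $H=(V,\mathcal E)$ be a $k$-uniform hypergraph with $V=\{0,\dots,n-1\}$, $n\ge 1$, and maximum degree $\Delta$; $H$ is *simple* if any two distinct hyperedges share at most one vertex. Let $s=\lceil\sqrt q\,\rceil$ and let $h:[q]\to[s]$ be a balanced projection scheme, i.e. $1\le s\le q$ and $|h^{-1}(j)|\in\{\lfloor q/s\rfloor,\lceil q/s\rceil\}$ for all $j\in[s]$. For $\Lambda\subseteq V$ and $Y\in[s]^\Lambda$, a hyperedge $e$ is *satisfied* by $Y$ if $Y_u\ne Y_w$ for some $u,w\in e\cap\Lambda$. Let $H^{Y}$ be $H$ with all satisfied hyperedges removed, and let $H^Y_v=(V^Y_v,\mathcal E^Y_v)$ be the connected component of $H^Y$ containing $v$. **$\mathrm{Sample}(H,h,S,Y,\zeta)$** (with $S\subseteq V$, $Y\in[s]^\Lambda$). Consider the connected components of $H^Y$ that meet $S$. 1. If one of them has more than $4\Delta k^3\log(n\Delta/\zeta)$ hyperedges, return a uniformly random element of $[q]^S$ (*failure on component size*). 2. Otherwise, for each of these components in turn, colour its vertices independently, each $w$ uniformly from $h^{-1}(Y_w)$ if $w\in\Lambda$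 and from $[q]$ if $w\notin\Lambda$. Repeat until no hyperedge of the component is monochromatic, at most $R=\big\lceil 10(n\Delta/\zeta)^{1/(1000\eta)}\log(n/\zeta)\big\rceil$ times, where $\eta=\frac1\Delta(q/100)^{(k-3)/2}$. 3. If all $R$ trials fail for some component, return a uniformly random element of $[q]^S$. Otherwise return the restriction to $S$ of the colourings found. **Algorithm** (with error bound $\epsilon\in(0,1)$). Let $T=\lceil 50n\log(2n\Delta/\epsilon)\rceil$ and let $Y_0\in[s]^V$ be uniformly random. For $t=1,\dots,T$, let $v_t$ be the vertex $t \bmod n$, draw $X'\leftarrow\mathrm{Sample}(H,h,\{v_t\},Y_{t-1}(V\setminus\{v_t\}),\epsilon/(4T))$, and obtain $Y_t$ from $Y_{t-1}$ by replacing the value at $v_t$ by $h(X')$. Finally (call $T+1$) call $\mathrm{Sample}(H,h,V,Y_T,\epsilon/(4T))$. For $1\le t\le T+1$ put $\Lambda=V\setminus\{v_t\}$ and $S=\{v_t\}$ if $t\le T$, and $\Lambda=S=V$ if $t=T+1$. Let $Y=Y_{t-1}(\Lambda)$ be the random input configuration of the $t$-th call of $\mathrm{Sample}$. **Lemma.**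 Let $\delta>0$, $k\ge \frac{20(1+\delta)}{\delta}$, $q\ge 100\,\Delta^{\frac{2+\delta}{k-4/\delta-3}}$, and let $H$ be simple. Then for every balanced projection scheme $h$, every $\epsilon\in(0,1)$, every $1\le t\le T+1$ and every $\zeta\in(0,1)$ (the algorithm itself uses $\zeta=\epsilon/(4T)$), the following hold. * For every $v\in V$ and every hyperedge $e\in\mathcal E$ with $v\in e$, $$\Pr_{Y}\Big[e\in\mathcal E^{Y}_v\ \text{ and }\ |\mathcal E^{Y}_v|\ge 4\Delta k^3\log\Big(\frac{n\Delta}{\zeta}\Big)\Big]\le\frac{\zeta}{n\Delta}.$$ * $\mathrm{Sample}(H,h,S,Y,\zeta)$, run on the random input $Y$ of the $t$-th call, fails on component size with probability at most $\zeta$. -/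

import Mathlib

noncomputable section

namespace HypergraphColouring

/-! ### Hypergraphs -/

/-- Every hyperedge has exactly `k` vertices. -/
def IsUniform {V : Type*} (H : Hypergraph V) (k : ℕ) : Prop :=
  ∀ e ∈ H.edgeSet, e.ncard = k

/-- Any two distinct hyperedges share at most one vertex. -/
def IsSimple {V : Type*} (H : Hypergraph V) : Prop :=
  ∀ e ∈ H.edgeSet, ∀ f ∈ H.edgeSet, e ≠ f → (e ∩ f).ncard ≤ 1

/-- The number of hyperedges incident to `v`. -/
def degree {V : Type*} (H : Hypergraph V) (v : V) : ℕ :=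
  {e ∈ H.edgeSet | v ∈ e}.ncard

/-- The maximum degree `Δ`. -/
def maxDegree {V : Type*} [Fintype V] (H : Hypergraph V) : ℕ :=
  Finset.univ.sup (degree H)

/-- The connected component of `v`, as a hypergraph: its vertices are those reachable from `v`
through hyperedges, its hyperedges are the hyperedges of `G` lying inside that vertex set. -/
def component {V : Type*} (G : Hypergraph V) (v : V) : Hypergraph V where
  vertexSet := {w | Relation.ReflTransGen G.Adj v w}
  edgeSet := {e ∈ G.edgeSet | e ⊆ {w | Relation.ReflTransGen G.Adj v w}}
  subset_vertexSet_of_mem_edgeSet' := fun _ he => he.2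

/-- A hyperedge is satisfied by the partial configuration `Y` on `Λ` if two of its vertices in `Λ`
receive different values. -/
def Satisfied {V α : Type*} {Λ : Finset V} (Y : Λ → α) (e : Set V) : Prop :=
  ∃ u w : Λ, (u : V) ∈ e ∧ (w : V) ∈ e ∧ Y u ≠ Y w

/-- The pruned hypergraph `H^Y`: all hyperedges satisfied by `Y` are removed. -/
def prune {V α : Type*} (H : Hypergraph V) {Λ : Finset V} (Y : Λ → α) : Hypergraph V where
  vertexSet := H.vertexSet
  edgeSet := {e ∈ H.edgeSet | ¬ Satisfied Y e}
  subset_vertexSet_of_mem_edgeSet' := fun _ he => H.subset_vertexSet_of_mem_edgeSet' he.1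

/-- A colouring of the vertices of `G` is proper if no hyperedge of `G` is monochromatic. -/
def IsProper {V α : Type*} (G : Hypergraph V) (X : G.vertexSet → α) : Prop :=
  ∀ e ∈ G.edgeSet, ∃ u w : G.vertexSet, (u : V) ∈ e ∧ (w : V) ∈ e ∧ X u ≠ X w

/-! ### Projection schemes -/

/-- A balanced projection scheme `h : [q] → [s]` with image size `s`, where `1 ≤ s ≤ q`. -/
structure ProjectionScheme (q s : ℕ) where
  toFun : Fin q → Fin s
  one_le : 1 ≤ s
  le : s ≤ q
  balanced : ∀ j : Fin s,
    (Finset.univ.filter fun c => toFun c = j).card = ⌊(q : ℚ) / s⌋₊ ∨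
    (Finset.univ.filter fun c => toFun c = j).card = ⌈(q : ℚ) / s⌉₊

namespace ProjectionScheme

variable {q s : ℕ}

/-- The bucket `h⁻¹(j)`. -/
def bucket (h : ProjectionScheme q s) (j : Fin s) : Finset (Fin q) :=
  Finset.univ.filter fun c => h.toFun c = j

theorem bucket_nonempty (h : ProjectionScheme q s) (j : Fin s) : (h.bucket j).Nonempty := by
  have hs : (0 : ℚ) < s := by exact_mod_cast h.one_le
  have h1 : (1 : ℚ) ≤ (q : ℚ) / s := by
    rw [le_div_iff₀ hs, one_mul]
    exact_mod_cast h.le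
  rw [← Finset.card_pos]
  rcases h.balanced j with hj | hj
  · exact lt_of_lt_of_eq (Nat.floor_pos.mpr h1) hj.symm
  · exact lt_of_lt_of_eq (Nat.ceil_pos.mpr (lt_of_lt_of_le one_pos h1)) hj.symm

theorem nonempty_colours (h : ProjectionScheme q s) : Nonempty (Fin q) :=
  ⟨⟨0, lt_of_lt_of_le h.one_le h.le⟩⟩

theorem nonempty_buckets (h : ProjectionScheme q s) : Nonempty (Fin s) :=
  ⟨⟨0, h.one_le⟩⟩

end ProjectionScheme

section Algorithm

variable {n q s : ℕ}

/-- The colour list `Q_v`: the bucket `h⁻¹(Y_v)` if `v ∈ Λ`, and all of `[q]` otherwise. -/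
def colourList (h : ProjectionScheme q s) {Λ : Finset (Fin n)} (Y : Λ → Fin s) (v : Fin n) :
    Finset (Fin q) :=
  if hv : v ∈ Λ then h.bucket (Y ⟨v, hv⟩) else Finset.univ

theorem colourList_nonempty (h : ProjectionScheme q s) {Λ : Finset (Fin n)} (Y : Λ → Fin s)
    (v : Fin n) : (colourList h Y v).Nonempty := by
  unfold colourList
  split_ifs
  · exact h.bucket_nonempty _
  · have := h.nonempty_colours
    exact Finset.univ_nonempty

/-! ### The rejection sampler -/

open scoped Classical in
/-- One trial: every vertex of `G` independently draws a uniform colour from its list. -/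
def drawColouring (G : Hypergraph (Fin n)) (h : ProjectionScheme q s) {Λ : Finset (Fin n)}
    (Y : Λ → Fin s) : PMF (G.vertexSet → Fin q) :=
  PMF.uniformOfFinset (Fintype.piFinset fun w : G.vertexSet => colourList h Y w)
    (Fintype.piFinset_nonempty.mpr fun w => colourList_nonempty h Y w)

open scoped Classical in
/-- `RejSample(G, h, Y, R)`: at most `R` independent trials; the first proper colouring is returned,
and `none` (the symbol `⊥`) if there is none. -/
def rejSample (G : Hypergraph (Fin n)) (h : ProjectionScheme q s) {Λ : Finset (Fin n)}
    (Y : Λ → Fin s) : ℕ → PMF (Option (G.vertexSet → Fin q))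
  | 0 => PMF.pure none
  | R + 1 => (drawColouring G h Y).bind fun X =>
      if IsProper G X then PMF.pure (some X) else rejSample G h Y R

/-! ### The subroutine `Sample` -/

/-- The component-size threshold `4 Δ k³ log(nΔ/ζ)`. -/
def sizeThreshold (n k Δ : ℕ) (ζ : ℝ) : ℝ :=
  4 * Δ * (k : ℝ) ^ 3 * Real.log ((n : ℝ) * Δ / ζ)

/-- `η = (1/Δ) (q/100)^((k-3)/2)`. -/
def eta (k q Δ : ℕ) : ℝ :=
  1 / (Δ : ℝ) * ((q : ℝ) / 100) ^ (((k : ℝ) - 3) / 2)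

/-- The number of trials `R = ⌈10 (nΔ/ζ)^(1/(1000η)) log(n/ζ)⌉`. -/
def numTrials (n k q Δ : ℕ) (ζ : ℝ) : ℕ :=
  ⌈10 * ((n : ℝ) * Δ / ζ) ^ (1 / (1000 * eta k q Δ)) * Real.log ((n : ℝ) / ζ)⌉₊

/-- The three ways in which `Sample` may return. -/
inductive SampleExit
  | componentTooLarge
  | rejectionFailed
  | success

open scoped Classical in
/-- The connected components of `G` that meet `S`, each listed once. -/
def componentsMeeting (G : Hypergraph (Fin n)) (S : Finset (Fin n)) : List (Hypergraph (Fin n)) :=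
  (S.image (component G)).toList

open scoped Classical in
/-- Run the rejection sampler on the listed components one after the other, writing each result into
the colouring `X`; `none` as soon as one of them fails. -/
def colourComponents (h : ProjectionScheme q s) {Λ : Finset (Fin n)} (Y : Λ → Fin s) (R : ℕ) :
    List (Hypergraph (Fin n)) → (Fin n → Fin q) → PMF (Option (Fin n → Fin q))
  | [], X => PMF.pure (some X)
  | G :: L, X => (rejSample G h Y R).bind fun r =>
      match r with
      | none => PMF.pure none
      | some XG => colourComponents h Y R L
          (fun v => if hv : v ∈ G.vertexSet then XG ⟨v, hv⟩ else X v)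

/-- A uniformly random element of `[q]^S`. -/
def uniformColouring (h : ProjectionScheme q s) (S : Finset (Fin n)) : PMF (S → Fin q) :=
  haveI := h.nonempty_colours
  PMF.uniformOfFintype (S → Fin q)

open scoped Classical in
/-- `Sample(H, h, S, Y, ζ)` for a `k`-uniform `H`: the returned colouring of `S`, together with a
record of the line by which it was returned. The initial colouring handed to `colourComponents`
plays no role, since every vertex of `S` lies in one of the components. -/
def sample (H : Hypergraph (Fin n)) (k : ℕ) (h : ProjectionScheme q s) (S : Finset (Fin n))
    {Λ : Finset (Fin n)} (Y : Λ → Fin s) (ζ : ℝ) : PMF (SampleExit × (S → Fin q)) :=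
  if ∃ G ∈ componentsMeeting (prune H Y) S,
      sizeThreshold n k (maxDegree H) ζ < (G.edgeSet.ncard : ℝ) then
    (uniformColouring h S).map fun X => (SampleExit.componentTooLarge, X)
  else
    (colourComponents h Y (numTrials n k q (maxDegree H) ζ) (componentsMeeting (prune H Y) S)
      (fun _ => ⟨0, lt_of_lt_of_le h.one_le h.le⟩)).bind fun r =>
        match r with
        | none => (uniformColouring h S).map fun X => (SampleExit.rejectionFailed, X)
        | some X => PMF.pure (SampleExit.success, fun v => X v)

/-! ### The main algorithm -/

/-- The number of scan steps `T = ⌈50 n log(2nΔ/ε)⌉`. -/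
def numSteps (n Δ : ℕ) (ε : ℝ) : ℕ :=
  ⌈50 * (n : ℝ) * Real.log (2 * n * Δ / ε)⌉₊

/-- The vertex with label `t mod n`. -/
def scanVertex (n : ℕ) [NeZero n] (t : ℕ) : Fin n := Fin.ofNat n t

/-- The law of the bucket configuration `Y_t ∈ [s]^V` after `t` steps of the systematic scan with
error bound `ε`; `Y_0` is uniform. In each step `Sample` is called with error bound `ε/(4T)`. -/
def scan [NeZero n] (H : Hypergraph (Fin n)) (k : ℕ) (h : ProjectionScheme q s) (ε : ℝ) :
    ℕ → PMF (Fin n → Fin s)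
  | 0 =>
      haveI := h.nonempty_buckets
      PMF.uniformOfFintype (Fin n → Fin s)
  | t + 1 => (scan H k h ε t).bind fun Y =>
      (sample H k h {scanVertex n (t + 1)}
        (fun w : (({scanVertex n (t + 1)} : Finset (Fin n))ᶜ : Finset (Fin n)) => Y w)
        (ε / (4 * numSteps n (maxDegree H) ε))).map fun r =>
          Function.update Y (scanVertex n (t + 1))
            (h.toFun (r.2 ⟨scanVertex n (t + 1), Finset.mem_singleton_self _⟩))

/-- The set `S` that the `t`-th call of `Sample` is asked to colour, `1 ≤ t ≤ T + 1`: the scanned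
vertex for `t ≤ T`, and all vertices in the final call `t = T + 1`. -/
def callTarget (n : ℕ) [NeZero n] (T t : ℕ) : Finset (Fin n) :=
  if t ≤ T then {scanVertex n t} else Finset.univ

/-- The set `Λ` on which the input configuration of the `t`-th call of `Sample` is defined,
`1 ≤ t ≤ T + 1`. -/
def callDomain (n : ℕ) [NeZero n] (T t : ℕ) : Finset (Fin n) :=
  if t ≤ T then {scanVertex n t}ᶜ else Finset.univ

/-- The law of the random partial configuration `Y = Y_{t-1}(Λ)` that is the input of the `t`-th
call of `Sample` in the algorithm run with error bound `ε`. -/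
def callInput [NeZero n] (H : Hypergraph (Fin n)) (k : ℕ) (h : ProjectionScheme q s) (ε : ℝ)
    (t : ℕ) : PMF (callDomain n (numSteps n (maxDegree H) ε) t → Fin s) :=
  (scan H k h ε (t - 1)).map fun Y w => Y w

/-- The law of the outcome of `Sample(H, h, S, Y, ζ)` on the random input `Y` of the `t`-th call.
The call made by the algorithm has `ζ = ε/(4T)`. -/
def callOutcome [NeZero n] (H : Hypergraph (Fin n)) (k : ℕ) (h : ProjectionScheme q s) (ε : ℝ)
    (t : ℕ) (ζ : ℝ) :
    PMF (SampleExit × (callTarget n (numSteps n (maxDegree H) ε) t → Fin q)) :=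
  (callInput H k h ε t).bind fun Y =>
    sample H k h (callTarget n (numSteps n (maxDegree H) ε) t) Y ζ

end Algorithm

end HypergraphColouring

end

namespace HypergraphColouring

open Finset
open scoped Classical ENNReal

/-! ### Counting rooted connected sets -/

section Grows

variable {α : Type*} [DecidableEq α]

/-! A hyperedge survives pruning only if `Y` is constant on its vertices in `Λ`, so a large
component is a large connected set of such hyperedges. Its probability is bounded by a union bound
over combinatorial witnesses.

Randomness: whatever the other buckets are, a scan step gives the scanned vertex v any fixed bucket
with probability at most β = 1.12/√q. Without the hyperedges through v its colour would be uniform,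
and by the local lemma these hyperedges change little (`card_proper_apply_mem_le`); rejection and
the uniform fallback keep the bound (`sample_singleton_le`). By induction on time, a prescribed
pattern on `A` has probability at most β^|A| (`scan_le`). Hence hyperedges that own disjoint sets of
a vertices are all monochromatic there with probability at most sβ^a per hyperedge
(`toOuterMeasure_forall_monoOn_le`).

Witnesses: a large component contains m + 1 vertex-disjoint blocks, each a connected set of θ =
⌈4/δ⌉ hyperedges, linked by steps of distance two (`exists_blockFamily`). By simplicity a hyperedge
shares at most θ - 1 vertices with the rest of its block, and `Λ` misses at most one vertex, so k -
θ private vertices remain (`exists_private_vertices`).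

Counting: a percolation argument (`card_grows_le`) bounds the number of choices per block by
Δ^(θ+2), up to factors in k and θ. That is Δ^(1+2/θ) per hyperedge, and 2/θ ≤ δ/2 is what the lower
bound on q can pay for; blocks of a single hyperedge would cost Δ^3. The expected number of
witnesses is then at most 2^(-θ(m+1)) (`block_weight_le`). The second claim is a union bound over
the at most nΔ incident pairs of a vertex and a hyperedge. -/

/-- The finite sets that can be built from `{r}` by repeatedly adding an `R`-successor of an element
already present. -/
inductive Grows (R : α → α → Prop) (r : α) : Finset α → Prop
  | base : Grows R r {r}
  | step {S : Finset α} {a b : α} : Grows R r S → a ∈ S → R a b → b ∉ S → Grows R r (insert b S)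

theorem Grows.root_mem {R : α → α → Prop} {r : α} {S : Finset α} (h : Grows R r S) : r ∈ S := by
  induction h with
  | base => simp
  | step _ _ _ _ ih => exact mem_insert_of_mem ih

/-- Growth inside `O` can never leave `T`. This makes the grown set cut out by a given `O` unique in
`card_grows_le`. -/
theorem Grows.subset_of_closed {R : α → α → Prop} {r : α} {S : Finset α} (h : Grows R r S)
    {O T : Finset α} (hSO : S ⊆ O) (hr : r ∈ T) (hT : ∀ a ∈ T, ∀ b ∈ O, R a b → b ∈ T) :
    S ⊆ T := by
  induction h with
  | base => simpa using hr
  | step _ ha hab _ ih =>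
    have hS := ih ((subset_insert _ _).trans hSO)
    exact insert_subset (hT _ (hS ha) _ (hSO (mem_insert_self _ _)) hab) hS

variable [Fintype α]

/-- The total Bernoulli weight of the sets that contain `A` and avoid `C`. -/
theorem sum_bernoulli_cylinder (p : ℝ) (A C : Finset α) (hAC : Disjoint A C) :
    ∑ O : Finset α, (if A ⊆ O ∧ Disjoint O C then p ^ O.card * (1 - p) ^ (univ \ O).card else 0)
      = p ^ A.card * (1 - p) ^ C.card := by
  -- In the expansion, choosing the first summand at i means i ∈ O. Setting the first summand to
  -- zero on `C` and the second to zero on `A` kills exactly the sets outside the cylinder.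
  have key := prod_add (fun i : α => if i ∈ C then 0 else p)
    (fun i : α => if i ∈ A then 0 else 1 - p) univ
  have hL : ∏ i : α, ((if i ∈ C then 0 else p) + (if i ∈ A then 0 else 1 - p))
      = p ^ A.card * (1 - p) ^ C.card := by
    have : ∀ i : α, ((if i ∈ C then 0 else p) + (if i ∈ A then 0 else 1 - p))
        = (if i ∈ A then p else 1) * (if i ∈ C then 1 - p else 1) := by
      intro i
      by_cases hA : i ∈ A
      · have hC : i ∉ C := disjoint_left.mp hAC hA
        simp [hA, hC]
      · by_cases hC : i ∈ C <;> simp [hA, hC]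
    simp_rw [this, prod_mul_distrib]
    simp [prod_ite_mem]
  rw [hL, powerset_univ] at key
  rw [key]
  refine sum_congr rfl fun O _ => ?_
  split_ifs with h
  · congr 1
    · rw [prod_congr rfl (g := fun _ => p), prod_const]
      intro i hi
      rw [if_neg (disjoint_left.mp h.2 hi)]
    · rw [prod_congr rfl (g := fun _ => 1 - p), prod_const]
      intro i hi
      rw [if_neg fun hA => (mem_sdiff.mp hi).2 (h.1 hA)]
  · rw [not_and_or] at h
    symm
    rcases h with h | h
    · obtain ⟨i, hiA, hiO⟩ := not_subset.mp h
      rw [mul_eq_zero]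
      exact Or.inr (prod_eq_zero (mem_sdiff.mpr ⟨mem_univ i, hiO⟩) (by simp [hiA]))
    · obtain ⟨i, hiO, hiC⟩ := not_disjoint_iff.mp h
      rw [mul_eq_zero]
      exact Or.inl (prod_eq_zero hiO (by simp [hiC]))

/-- If every element has at most `D` successors, there are at most `2 (4D)^m` sets with `m + 1`
elements that grow from a given root. -/
theorem card_grows_le (R : α → α → Prop) (r : α) (D : ℕ) (hD : 1 ≤ D)
    (hdeg : ∀ a, (univ.filter (R a)).card ≤ D) (m : ℕ) :
    (univ.filter fun S : Finset α => Grows R r S ∧ S.card = m + 1).card ≤ 2 * (4 * D) ^ m := by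
  set 𝒮 := univ.filter fun S : Finset α => Grows R r S ∧ S.card = m + 1 with h𝒮
  let bd : Finset α → Finset α := fun S => univ.filter fun b => b ∉ S ∧ ∃ a ∈ S, R a b
  have hD' : (1 : ℝ) ≤ D := by exact_mod_cast hD
  -- Site percolation: each element is open with probability p. For S in `𝒮` consider the event that
  -- S is open and its out-boundary `bd S` is closed. These events are disjoint, force r to be open,
  -- and each has probability at least (p/2)^(m+1), since (1-p)^D ≥ 1/2. So |𝒮| (p/2)^(m+1) ≤ p.
  set p : ℝ := 1 / (2 * D) with hp
  have hp0 : 0 < p := by positivity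
  have hp1 : p ≤ 1 / 2 := by
    rw [hp]; apply one_div_le_one_div_of_le <;> linarith
  let w : Finset α → ℝ := fun O => p ^ O.card * (1 - p) ^ (univ \ O).card
  have hw : ∀ O, 0 ≤ w O := fun O => mul_nonneg (by positivity) (pow_nonneg (by linarith) _)
  have hbd : ∀ S, Disjoint S (bd S) := fun S => disjoint_left.mpr fun i hi hb => by
    simp only [bd, mem_filter] at hb
    exact hb.2.1 hi
  have hbdcard : ∀ S ∈ 𝒮, (bd S).card ≤ D * (m + 1) := by
    intro S hS
    have hc : S.card = m + 1 := (mem_filter.mp hS).2.2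
    calc (bd S).card ≤ (S.biUnion fun a => univ.filter (R a)).card := by
          refine card_le_card fun b hb => ?_
          simp only [bd, mem_filter, mem_univ, true_and] at hb
          obtain ⟨a, ha, hab⟩ := hb.2
          exact mem_biUnion.mpr ⟨a, ha, by simpa using hab⟩
      _ ≤ ∑ a ∈ S, D := card_biUnion_le.trans (sum_le_sum fun a _ => hdeg a)
      _ = D * (m + 1) := by rw [sum_const, hc, smul_eq_mul, mul_comm]
  -- Each of S and T would have to be the set reached from r inside O.
  have huniq : ∀ O : Finset α, ∀ S ∈ 𝒮, ∀ T ∈ 𝒮, (S ⊆ O ∧ Disjoint O (bd S)) →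
      (T ⊆ O ∧ Disjoint O (bd T)) → S ⊆ T := by
    intro O S hS T hT hSO hTO
    refine (mem_filter.mp hS).2.1.subset_of_closed hSO.1 (mem_filter.mp hT).2.1.root_mem ?_
    intro a ha b hb hab
    by_contra hbT
    exact disjoint_left.mp hTO.2 hb (by simpa [bd] using ⟨hbT, a, ha, hab⟩)
  have hlow : ∀ S ∈ 𝒮, p ^ (m + 1) * (1 / 2) ^ (m + 1) ≤
      ∑ O : Finset α, (if S ⊆ O ∧ Disjoint O (bd S) then w O else 0) := by
    intro S hS
    rw [sum_bernoulli_cylinder p S (bd S) (hbd S), (mem_filter.mp hS).2.2]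
    refine mul_le_mul_of_nonneg_left ?_ (by positivity)
    have h1 : (1 / 2 : ℝ) ≤ (1 - p) ^ D := by
      have := one_add_mul_le_pow (a := -p) (by linarith) D
      have hDp : (D : ℝ) * p = 1 / 2 := by rw [hp]; field_simp
      calc (1 / 2 : ℝ) = 1 + D * -p := by rw [mul_neg, hDp]; norm_num
        _ ≤ (1 + -p) ^ D := this
        _ = (1 - p) ^ D := by ring
    calc (1 / 2 : ℝ) ^ (m + 1) ≤ ((1 - p) ^ D) ^ (m + 1) := pow_le_pow_left₀ (by norm_num) h1 _
      _ = (1 - p) ^ (D * (m + 1)) := by rw [pow_mul]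
      _ ≤ (1 - p) ^ (bd S).card :=
        pow_le_pow_of_le_one (by linarith) (by linarith) (hbdcard S hS)
  have hup : ∑ S ∈ 𝒮, ∑ O : Finset α, (if S ⊆ O ∧ Disjoint O (bd S) then w O else 0) ≤ p := by
    rw [sum_comm]
    have hroot := sum_bernoulli_cylinder p {r} ∅ (by simp)
    simp only [card_singleton, pow_one, card_empty, pow_zero, mul_one] at hroot
    rw [← hroot]
    refine sum_le_sum fun O _ => ?_
    by_cases hex : ∃ S ∈ 𝒮, S ⊆ O ∧ Disjoint O (bd S)
    · obtain ⟨S, hS, hSO⟩ := hex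
      rw [sum_eq_single_of_mem S hS, if_pos hSO, if_pos]
      · exact ⟨singleton_subset_iff.mpr (hSO.1 (mem_filter.mp hS).2.1.root_mem), by simp⟩
      · intro T hT hne
        rw [if_neg]
        intro hTO
        exact hne (subset_antisymm (huniq O T hT S hS hTO hSO) (huniq O S hS T hT hSO hTO))
    · push Not at hex
      rw [sum_eq_zero fun S hS => if_neg fun hh => hex S hS hh.1 hh.2]
      split_ifs
      exacts [hw O, le_rfl]
  have hcount : (𝒮.card : ℝ) * (p ^ (m + 1) * (1 / 2) ^ (m + 1)) ≤ p := by
    rw [← nsmul_eq_mul]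
    exact (card_nsmul_le_sum _ _ _ hlow).trans hup
  have hval : p ^ (m + 1) * (1 / 2) ^ (m + 1) * (2 * (4 * (D : ℝ)) ^ m) = p := by
    have : p * (4 * D) = 2 := by rw [hp]; field_simp; norm_num
    calc p ^ (m + 1) * (1 / 2) ^ (m + 1) * (2 * (4 * (D : ℝ)) ^ m)
        = (p * (4 * D) * (1 / 2)) ^ m * p := by simp only [mul_pow, pow_succ]; ring
      _ = p := by rw [this]; norm_num
  have : (𝒮.card : ℝ) ≤ 2 * (4 * (D : ℝ)) ^ m := by
    have hpos : 0 < p ^ (m + 1) * (1 / 2 : ℝ) ^ (m + 1) := by positivity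
    refine le_of_mul_le_mul_right ?_ hpos
    calc (𝒮.card : ℝ) * (p ^ (m + 1) * (1 / 2) ^ (m + 1)) ≤ p := hcount
      _ = 2 * (4 * (D : ℝ)) ^ m * (p ^ (m + 1) * (1 / 2) ^ (m + 1)) := by rw [mul_comm, hval]
  exact_mod_cast this

end Grows

/-! ### Blocks of hyperedges -/

section Blocks

variable {V ι : Type*} [Fintype ι]

/-- Two members of `E` that share a vertex. -/
def Touch (vs : ι → Finset V) (E : Finset ι) (e f : ι) : Prop :=
  e ∈ E ∧ f ∈ E ∧ ¬ Disjoint (vs e) (vs f)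

/-- `B` is a connected set of `θ` hyperedges containing `e`. -/
def IsBlock (vs : ι → Finset V) (E : Finset ι) (θ : ℕ) (e : ι) (B : Finset ι) : Prop :=
  Grows (Touch vs E) e B ∧ B.card = θ

/-- `B'` is a block that contains a hyperedge at distance at most two from `B`. -/
def BlockAdj (vs : ι → Finset V) (E : Finset ι) (θ : ℕ) (B B' : Finset ι) : Prop :=
  ∃ a ∈ B, ∃ f, Touch vs E a f ∧ ∃ b, Touch vs E f b ∧ IsBlock vs E θ b B'

/-- Distinct members of `𝓕` are vertex disjoint. -/
def FarApart (vs : ι → Finset V) (𝓕 : Finset (Finset ι)) : Prop :=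
  ∀ B ∈ 𝓕, ∀ B' ∈ 𝓕, B ≠ B' → ∀ a ∈ B, ∀ b ∈ B', Disjoint (vs a) (vs b)

/-- Inside `X`, either a block of `θ` hyperedges grows from `b`, or `b` lies in a closed part with
fewer than `θ` hyperedges. -/
theorem exists_block_or_closed (vs : ι → Finset V) (E : Finset ι) {X : Finset ι} {b : ι}
    (hb : b ∈ X) {θ : ℕ} (hθ : 1 ≤ θ) :
    (∃ B ⊆ X, IsBlock vs E θ b B) ∨
      ∃ C ⊆ X, b ∈ C ∧ C.card < θ ∧ ∀ c ∈ C, ∀ x ∈ X, Touch vs E c x → x ∈ C := by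
  induction θ, hθ using Nat.le_induction with
  | base => exact Or.inl ⟨{b}, singleton_subset_iff.mpr hb, Grows.base, card_singleton b⟩
  | succ θ _ ih =>
    rcases ih with ⟨B, hBX, hB⟩ | ⟨C, hCX, hbC, hC, hcl⟩
    · by_cases hcl : ∀ c ∈ B, ∀ x ∈ X, Touch vs E c x → x ∈ B
      · exact Or.inr ⟨B, hBX, hB.1.root_mem, by rw [hB.2]; omega, hcl⟩
      · push Not at hcl
        obtain ⟨c, hc, x, hx, hcx, hxB⟩ := hcl
        exact Or.inl ⟨insert x B, insert_subset hx hBX, hB.1.step hc hcx hxB, by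
          rw [card_insert_of_notMem hxB, hB.2]⟩
    · exact Or.inr ⟨C, hCX, hbC, by omega, hcl⟩

variable [DecidableEq V]

theorem card_touch_le {vs : ι → Finset V} {E : Finset ι} {k Δ : ℕ}
    (hk : ∀ e ∈ E, (vs e).card = k) (hΔ : ∀ v, (E.filter fun f => v ∈ vs f).card ≤ Δ) (e : ι) :
    (univ.filter (Touch vs E e)).card ≤ k * Δ := by
  by_cases he : e ∈ E
  · calc (univ.filter (Touch vs E e)).card
        ≤ ((vs e).biUnion fun v => E.filter fun f => v ∈ vs f).card := by
          refine card_le_card fun f hf => ?_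
          obtain ⟨_, hfE, hd⟩ := (mem_filter.mp hf).2
          obtain ⟨v, hve, hvf⟩ := not_disjoint_iff.mp hd
          exact mem_biUnion.mpr ⟨v, hve, mem_filter.mpr ⟨hfE, hvf⟩⟩
      _ ≤ ∑ v ∈ vs e, Δ := card_biUnion_le.trans (sum_le_sum fun v _ => hΔ v)
      _ = k * Δ := by rw [sum_const, hk e he, smul_eq_mul]
  · rw [filter_false_of_mem fun f _ hf => he hf.1]
    simp

theorem card_block_le {vs : ι → Finset V} {E : Finset ι} {k Δ θ : ℕ}
    (hk : ∀ e ∈ E, (vs e).card = k) (hΔ : ∀ v, (E.filter fun f => v ∈ vs f).card ≤ Δ)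
    (hkΔ : 1 ≤ k * Δ) (hθ : 1 ≤ θ) (e : ι) :
    (univ.filter (IsBlock vs E θ e)).card ≤ (4 * (k * Δ)) ^ θ := by
  obtain ⟨m, rfl⟩ := Nat.exists_eq_add_of_le' hθ
  calc (univ.filter (IsBlock vs E (m + 1) e)).card
      ≤ 2 * (4 * (k * Δ)) ^ m :=
        (card_le_card fun B hB => by simpa [IsBlock] using hB).trans
          (card_grows_le (Touch vs E) e (k * Δ) hkΔ (card_touch_le hk hΔ) m)
    _ ≤ (4 * (k * Δ)) ^ m * (4 * (k * Δ)) := by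
        rw [mul_comm]; exact Nat.mul_le_mul_left _ (by omega)
    _ = (4 * (k * Δ)) ^ (m + 1) := (pow_succ _ _).symm

/-- Choose a in `B`, two touching steps, then a block at the end. The two steps cost (kΔ)^2, paid
once per block and not once per hyperedge. -/
theorem card_blockAdj_le {vs : ι → Finset V} {E : Finset ι} {k Δ θ : ℕ}
    (hk : ∀ e ∈ E, (vs e).card = k) (hΔ : ∀ v, (E.filter fun f => v ∈ vs f).card ≤ Δ)
    (hkΔ : 1 ≤ k * Δ) (hθ : 1 ≤ θ) {B : Finset ι} (hB : B.card = θ) :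
    (univ.filter (BlockAdj vs E θ B)).card ≤ θ * ((k * Δ) * ((k * Δ) * (4 * (k * Δ)) ^ θ)) := by
  have hsub : univ.filter (BlockAdj vs E θ B) ⊆
      B.biUnion fun a => (univ.filter (Touch vs E a)).biUnion fun f =>
        (univ.filter (Touch vs E f)).biUnion fun b => univ.filter (IsBlock vs E θ b) := by
    intro B' hB'
    obtain ⟨a, ha, f, hf, b, hb, hbB⟩ := (mem_filter.mp hB').2
    simp only [mem_biUnion, mem_filter, mem_univ, true_and]
    exact ⟨a, ha, f, hf, b, hb, hbB⟩
  refine (card_le_card hsub).trans ?_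
  rw [← hB]
  refine card_biUnion_le_card_mul _ _ _ fun a _ => ?_
  refine (card_biUnion_le_card_mul _ _ _ fun f _ => ?_).trans
    (Nat.mul_le_mul_right _ (card_touch_le hk hΔ a))
  refine (card_biUnion_le_card_mul _ _ _ fun b _ => ?_).trans
    (Nat.mul_le_mul_right _ (card_touch_le hk hΔ f))
  rw [hB]
  exact card_block_le hk hΔ hkΔ hθ b

/-- The number of families of `m + 1` blocks that grow from one of the blocks around `e`. -/
theorem card_blockFamily_le {vs : ι → Finset V} {E : Finset ι} {k Δ θ : ℕ}
    (hk : ∀ e ∈ E, (vs e).card = k) (hΔ : ∀ v, (E.filter fun f => v ∈ vs f).card ≤ Δ)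
    (hkΔ : 1 ≤ k * Δ) (hθ : 1 ≤ θ) (e : ι) (m : ℕ) :
    (univ.filter fun 𝓕 : Finset (Finset ι) => (∃ B₀, IsBlock vs E θ e B₀ ∧
        Grows (fun B B' => B.card = θ ∧ BlockAdj vs E θ B B') B₀ 𝓕) ∧ 𝓕.card = m + 1).card
      ≤ (4 * (θ * ((k * Δ) * ((k * Δ) * (4 * (k * Δ)) ^ θ)))) ^ (m + 1) := by
  set D := θ * ((k * Δ) * ((k * Δ) * (4 * (k * Δ)) ^ θ)) with hD
  have hpow : 1 ≤ (4 * (k * Δ)) ^ θ := Nat.one_le_pow _ _ (by omega)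
  have hle : (4 * (k * Δ)) ^ θ ≤ D := by
    calc (4 * (k * Δ)) ^ θ = 1 * (1 * (1 * (4 * (k * Δ)) ^ θ)) := by ring
      _ ≤ D := Nat.mul_le_mul hθ (Nat.mul_le_mul hkΔ (Nat.mul_le_mul_right _ hkΔ))
  have hsub : (univ.filter fun 𝓕 : Finset (Finset ι) => (∃ B₀, IsBlock vs E θ e B₀ ∧
        Grows (fun B B' => B.card = θ ∧ BlockAdj vs E θ B B') B₀ 𝓕) ∧ 𝓕.card = m + 1) ⊆
      (univ.filter (IsBlock vs E θ e)).biUnion fun B₀ => univ.filter fun 𝓕 =>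
        Grows (fun B B' => B.card = θ ∧ BlockAdj vs E θ B B') B₀ 𝓕 ∧ 𝓕.card = m + 1 := by
    intro 𝓕 h𝓕
    obtain ⟨⟨B₀, hB₀, hg⟩, hc⟩ := (mem_filter.mp h𝓕).2
    simp only [mem_biUnion, mem_filter, mem_univ, true_and]
    exact ⟨B₀, hB₀, hg, hc⟩
  calc _ ≤ _ := card_le_card hsub
    _ ≤ (univ.filter (IsBlock vs E θ e)).card * (2 * (4 * D) ^ m) := by
        refine card_biUnion_le_card_mul _ _ _ fun B₀ _ => ?_
        refine card_grows_le _ B₀ D (hpow.trans hle) (fun B => ?_) m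
        -- The clause `B.card = θ` in the growth relation leaves sets of any other size without
        -- successors, so `D` bounds every out-degree.
        by_cases hB : B.card = θ
        · simpa [hB] using card_blockAdj_le hk hΔ hkΔ hθ hB
        · simp [hB]
    _ ≤ D * (2 * (4 * D) ^ m) :=
        Nat.mul_le_mul_right _ ((card_block_le hk hΔ hkΔ hθ e).trans hle)
    _ ≤ (4 * D) ^ (m + 1) := by
        rw [pow_succ, ← mul_assoc, mul_comm]
        exact Nat.mul_le_mul_left _ (by omega)

/-- `U` cannot be split into two nonempty parts without a common vertex. -/
def EdgeConnected (vs : ι → Finset V) (E U : Finset ι) : Prop :=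
  ∀ A ⊆ U, A.Nonempty → A ≠ U → ∃ a ∈ A, ∃ x ∈ U, x ∉ A ∧ Touch vs E a x

/-- A connected set of hyperedges that is much larger than the neighbourhood `N` of `W` contains a
block outside `N` next to it. -/
theorem exists_block_near {vs : ι → Finset V} {E U W : Finset ι} {k Δ θ : ℕ}
    (hk : ∀ e ∈ E, (vs e).card = k) (hΔ : ∀ v, (E.filter fun f => v ∈ vs f).card ≤ Δ)
    (hk1 : 1 ≤ k) (hθ : 1 ≤ θ) (hUE : U ⊆ E) (hconn : EdgeConnected vs E U)
    (hWU : W ⊆ U) (hW : W.Nonempty) (hcard : W.card * (k * Δ) * (k * θ) < U.card) :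
    ∃ a ∈ W, ∃ f, Touch vs E a f ∧ ∃ b, Touch vs E f b ∧ ∃ B ⊆ U, IsBlock vs E θ b B ∧
      ∀ x ∈ B, ∀ a ∈ W, Disjoint (vs a) (vs x) := by
  set N := U.filter fun f => ∃ a ∈ W, Touch vs E a f with hN
  have hself : ∀ e ∈ E, Touch vs E e e := fun e he => ⟨he, he, by
    rw [disjoint_self]
    intro h0
    have := hk e he
    rw [h0] at this
    simp at this
    omega⟩
  have hWN : W ⊆ N := fun a ha => mem_filter.mpr ⟨hWU ha, a, ha, hself a (hUE (hWU ha))⟩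
  by_cases hex : ∃ f ∈ N, ∃ b ∈ U \ N, Touch vs E f b ∧ ∃ B ⊆ U \ N, IsBlock vs E θ b B
  · obtain ⟨f, hf, b, -, hfb, B, hBU, hB⟩ := hex
    obtain ⟨_, a, ha, haf⟩ := mem_filter.mp hf
    refine ⟨a, ha, f, haf, b, hfb, B, hBU.trans sdiff_subset, hB, fun x hx a' ha' => ?_⟩
    by_contra hd
    have hxU := mem_sdiff.mp (hBU hx)
    exact hxU.2 (mem_filter.mpr ⟨hxU.1, a', ha', hUE (hWU ha'), hUE hxU.1, hd⟩)
  · exfalso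
    have hsmall : ∀ f ∈ N, ∀ b ∈ U \ N, Touch vs E f b →
        ∃ C ⊆ U \ N, b ∈ C ∧ C.card < θ ∧ ∀ c ∈ C, ∀ x ∈ U \ N, Touch vs E c x → x ∈ C := by
      intro f hf b hb hfb
      rcases exists_block_or_closed vs E hb hθ with ⟨B, hBU, hB⟩ | h
      · exact absurd ⟨f, hf, b, hb, hfb, B, hBU, hB⟩ hex
      · exact h
    -- The closed parts are indexed by the vertices u of `N` and not by the hyperedges next to `N`:
    -- hyperedges through the same u touch each other, hence share a part. This saves a factor Δ.
    have hcl : ∀ u ∈ N.biUnion vs, ∃ C ⊆ U \ N, C.card ≤ θ - 1 ∧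
        (∀ c ∈ C, ∀ x ∈ U \ N, Touch vs E c x → x ∈ C) ∧ ∀ x ∈ U \ N, u ∈ vs x → x ∈ C := by
      intro u hu
      obtain ⟨f, hf, huf⟩ := mem_biUnion.mp hu
      by_cases hb : ∃ b ∈ U \ N, u ∈ vs b
      · obtain ⟨b, hb, hub⟩ := hb
        obtain ⟨C, hCU, hbC, hCθ, hC⟩ := hsmall f hf b hb
          ⟨hUE (mem_filter.mp hf).1, hUE (mem_sdiff.mp hb).1, not_disjoint_iff.mpr ⟨u, huf, hub⟩⟩
        exact ⟨C, hCU, by omega, hC, fun x hx hux => hC b hbC x hx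
          ⟨hUE (mem_sdiff.mp hb).1, hUE (mem_sdiff.mp hx).1, not_disjoint_iff.mpr ⟨u, hub, hux⟩⟩⟩
      · push Not at hb
        exact ⟨∅, empty_subset _, by simp, by simp, fun x hx hux => absurd hux (hb x hx)⟩
    choose! C hCU hCθ hCcl hCu using hcl
    have hcover : N ∪ (N.biUnion vs).biUnion C = U := by
      by_contra hne
      have hsub : N ∪ (N.biUnion vs).biUnion C ⊆ U := union_subset (filter_subset _ _)
        (biUnion_subset.mpr fun u hu => (hCU u hu).trans sdiff_subset)
      obtain ⟨a, ha, x, hx, hxA, hax⟩ := hconn _ hsub (hW.mono (hWN.trans subset_union_left)) hne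
      rw [mem_union, not_or] at hxA
      have hxN : x ∈ U \ N := mem_sdiff.mpr ⟨hx, hxA.1⟩
      refine hxA.2 ?_
      rcases mem_union.mp ha with ha | ha
      · obtain ⟨u, hua, hux⟩ := not_disjoint_iff.mp hax.2.2
        have hu : u ∈ N.biUnion vs := mem_biUnion.mpr ⟨a, ha, hua⟩
        exact mem_biUnion.mpr ⟨u, hu, hCu u hu x hxN hux⟩
      · obtain ⟨u, hu, hau⟩ := mem_biUnion.mp ha
        exact mem_biUnion.mpr ⟨u, hu, hCcl u hu a hau x hxN hax⟩
    have hNcard : N.card ≤ W.card * (k * Δ) := by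
      refine (card_le_card (t := W.biUnion fun a => univ.filter (Touch vs E a)) ?_).trans
        (card_biUnion_le_card_mul _ _ _ fun a _ => card_touch_le hk hΔ a)
      intro f hf
      obtain ⟨_, a, ha, haf⟩ := mem_filter.mp hf
      exact mem_biUnion.mpr ⟨a, ha, by simpa using haf⟩
    have hVcard : (N.biUnion vs).card ≤ N.card * k :=
      card_biUnion_le_card_mul _ _ _ fun f hf => (hk f (hUE (mem_filter.mp hf).1)).le
    have hUcard : U.card ≤ N.card * (k * θ) := by
      obtain ⟨θ', rfl⟩ := Nat.exists_eq_add_of_le' hθ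
      rw [← hcover]
      calc _ ≤ N.card + ((N.biUnion vs).biUnion C).card := card_union_le _ _
        _ ≤ N.card + (N.biUnion vs).card * θ' :=
          Nat.add_le_add_left (card_biUnion_le_card_mul _ _ _ fun u hu => hCθ u hu) _
        _ ≤ N.card * k + N.card * k * θ' :=
          Nat.add_le_add (Nat.le_mul_of_pos_right _ hk1) (Nat.mul_le_mul_right _ hVcard)
        _ = N.card * (k * (θ' + 1)) := by ring
    exact absurd (hUcard.trans (Nat.mul_le_mul_right _ hNcard)) (not_le.mpr hcard)

/-- A large connected set of hyperedges contains many vertex-disjoint blocks, linked to one another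
through steps of distance two. -/
theorem exists_blockFamily {vs : ι → Finset V} {E U : Finset ι} {k Δ θ : ℕ}
    (hk : ∀ e ∈ E, (vs e).card = k) (hΔ : ∀ v, (E.filter fun f => v ∈ vs f).card ≤ Δ)
    (hk1 : 1 ≤ k) (hθ : 1 ≤ θ) (hUE : U ⊆ E) (hconn : EdgeConnected vs E U)
    {e : ι} (he : e ∈ U) (hθU : θ ≤ U.card) (m : ℕ)
    (hm : m * (θ * (k * Δ) * (k * θ)) < U.card) :
    ∃ 𝓕 : Finset (Finset ι), (∃ B₀, IsBlock vs E θ e B₀ ∧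
        Grows (fun B B' => B.card = θ ∧ BlockAdj vs E θ B B') B₀ 𝓕) ∧ 𝓕.card = m + 1 ∧
      (∀ B ∈ 𝓕, B ⊆ U ∧ B.card = θ) ∧ FarApart vs 𝓕 := by
  induction m with
  | zero =>
    rcases exists_block_or_closed vs E he hθ with ⟨B, hBU, hB⟩ | ⟨C, hCU, heC, hCθ, hC⟩
    · refine ⟨{B}, ⟨B, hB, Grows.base⟩, card_singleton B, ?_, ?_⟩
      · intro B' hB'
        rw [mem_singleton] at hB'
        subst hB'
        exact ⟨hBU, hB.2⟩
      · intro B₁ h₁ B₂ h₂ hne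
        rw [mem_singleton] at h₁ h₂
        exact absurd (h₁.trans h₂.symm) hne
    · have hne : C ≠ U := by rintro rfl; omega
      obtain ⟨a, ha, x, hx, hxC, hax⟩ := hconn C hCU ⟨e, heC⟩ hne
      exact absurd (hC a ha x hx hax) hxC
  | succ m ih =>
    obtain ⟨𝓕, ⟨B₀, hB₀, hg⟩, hc, hθ𝓕, hfar⟩ :=
      ih (lt_of_le_of_lt (Nat.mul_le_mul_right _ (Nat.le_succ m)) hm)
    have hWcard : (𝓕.biUnion id).card ≤ (m + 1) * θ := by
      rw [← hc]
      exact card_biUnion_le_card_mul _ _ _ fun B hB => (hθ𝓕 B hB).2.le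
    have hW : (𝓕.biUnion id).Nonempty :=
      ⟨e, mem_biUnion.mpr ⟨B₀, hg.root_mem, hB₀.1.root_mem⟩⟩
    obtain ⟨a, ha, f, haf, b, hfb, B, hBU, hB, hdis⟩ := exists_block_near (W := 𝓕.biUnion id)
      hk hΔ hk1 hθ hUE hconn (biUnion_subset.mpr fun B hB => (hθ𝓕 B hB).1) hW (by
        refine lt_of_le_of_lt ?_ hm
        calc (𝓕.biUnion id).card * (k * Δ) * (k * θ) ≤ (m + 1) * θ * (k * Δ) * (k * θ) :=
              Nat.mul_le_mul_right _ (Nat.mul_le_mul_right _ hWcard)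
          _ = _ := by ring)
    obtain ⟨B₁, hB₁, haB₁⟩ := mem_biUnion.mp ha
    have hself : ¬ Disjoint (vs b) (vs b) := by
      rw [disjoint_self]
      intro h0
      have := hk b hfb.2.1
      rw [h0] at this
      simp at this
      omega
    have hBnot : B ∉ 𝓕 := fun hmem =>
      hself (hdis b hB.1.root_mem b (mem_biUnion.mpr ⟨B, hmem, hB.1.root_mem⟩))
    refine ⟨insert B 𝓕, ⟨B₀, hB₀, hg.step hB₁ ⟨(hθ𝓕 B₁ hB₁).2, a, haB₁, f, haf, b, hfb, hB⟩ hBnot⟩,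
      by rw [card_insert_of_notMem hBnot, hc], ?_, ?_⟩
    · intro B' hB'
      rcases mem_insert.mp hB' with rfl | h'
      · exact ⟨hBU, hB.2⟩
      · exact hθ𝓕 B' h'
    · intro B' hB' B'' hB'' hne x hx y hy
      rcases mem_insert.mp hB' with rfl | h' <;> rcases mem_insert.mp hB'' with rfl | h''
      · exact absurd rfl hne
      · exact (hdis x hx y (mem_biUnion.mpr ⟨B'', h'', hy⟩)).symm
      · exact hdis y hy x (mem_biUnion.mpr ⟨B', h', hx⟩)
      · exact hfar B' h' B'' h'' hne x hx y hy

end Blocks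

/-! ### The local lemma -/

section LocalLemma

variable {X I : Type*}

/-- The points of `Ω` at which none of the bad events in `F` occurs. -/
noncomputable def avoiding (Ω : Finset X) (bad : I → X → Prop) (F : Finset I) : Finset X :=
  Ω.filter fun x => ∀ e ∈ F, ¬ bad e x

theorem avoiding_anti (Ω : Finset X) (bad : I → X → Prop) {F F' : Finset I} (h : F ⊆ F') :
    avoiding Ω bad F' ⊆ avoiding Ω bad F :=
  monotone_filter_right _ fun _ _ hx e he => hx e (h he)

theorem card_avoiding_le_add_sum (Ω : Finset X) (bad : I → X → Prop) (F M : Finset I) :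
    (avoiding Ω bad (F \ M)).card ≤ (avoiding Ω bad F).card +
      ∑ f ∈ F ∩ M, ((avoiding Ω bad (F \ M)).filter (bad f)).card := by
  refine le_trans (card_le_card (t := avoiding Ω bad F ∪
    (F ∩ M).biUnion fun f => (avoiding Ω bad (F \ M)).filter (bad f)) ?_)
    ((card_union_le _ _).trans (Nat.add_le_add_left card_biUnion_le _))
  intro x hx
  by_cases h : ∃ f ∈ F ∩ M, bad f x
  · obtain ⟨f, hf, hb⟩ := h
    exact mem_union_right _ (mem_biUnion.mpr ⟨f, hf, mem_filter.mpr ⟨hx, hb⟩⟩)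
  · push Not at h
    refine mem_union_left _ (mem_filter.mpr ⟨(mem_filter.mp hx).1, fun e he => ?_⟩)
    by_cases hM : e ∈ M
    · exact h e (mem_inter.mpr ⟨he, hM⟩)
    · exact (mem_filter.mp hx).2 e (mem_sdiff.mpr ⟨he, hM⟩)

/-- Union bound: restoring each constraint in `F ∩ M` loses at most a share 2p of the points. -/
theorem one_sub_mul_card_avoiding_le {Ω : Finset X} {bad : I → X → Prop} {F M : Finset I}
    {p : ℝ} {d : ℕ} (hp : 0 ≤ p) (hd : (F ∩ M).card ≤ d)
    (hbad : ∀ f ∈ F ∩ M, (((avoiding Ω bad (F \ M)).filter (bad f)).card : ℝ) ≤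
      2 * p * (avoiding Ω bad (F \ M)).card) :
    (1 - 2 * p * d) * ((avoiding Ω bad (F \ M)).card : ℝ) ≤ (avoiding Ω bad F).card := by
  have h1 : ((avoiding Ω bad (F \ M)).card : ℝ) ≤ (avoiding Ω bad F).card +
      ∑ f ∈ F ∩ M, (((avoiding Ω bad (F \ M)).filter (bad f)).card : ℝ) := by
    exact_mod_cast card_avoiding_le_add_sum Ω bad F M
  have h2 := sum_le_card_nsmul _ _ _ hbad
  rw [nsmul_eq_mul] at h2
  have h3 : ((F ∩ M).card : ℝ) * (2 * p * (avoiding Ω bad (F \ M)).card) ≤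
      d * (2 * p * (avoiding Ω bad (F \ M)).card) :=
    mul_le_mul_of_nonneg_right (by exact_mod_cast hd) (by positivity)
  linarith

/-- The lopsided symmetric local lemma in counting form. -/
theorem card_bad_avoiding_le {Ω : Finset X} {bad : I → X → Prop} {E : Finset I}
    {nb : I → Finset I} {p : ℝ} {d : ℕ} (hp : 0 ≤ p) (hpd : 4 * (p * d) ≤ 1)
    (hd : ∀ e ∈ E, (E ∩ nb e).card ≤ d)
    (hind : ∀ e ∈ E, ∀ F ⊆ E, Disjoint F (nb e) →
      (((avoiding Ω bad F).filter (bad e)).card : ℝ) ≤ p * (avoiding Ω bad F).card)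
    (F : Finset I) (hF : F ⊆ E) (e : I) (he : e ∈ E) :
    (((avoiding Ω bad F).filter (bad e)).card : ℝ) ≤ 2 * p * (avoiding Ω bad F).card := by
  induction hn : F.card using Nat.strong_induction_on generalizing F e with
  | _ n ih =>
    -- Forgetting the constraints near e only enlarges the left side, where independence gives the
    -- factor p. By induction the reference set grows by a factor of at most 1/(1 - 2pd) ≤ 2.
    have h0 : (((avoiding Ω bad F).filter (bad e)).card : ℝ) ≤
        ((avoiding Ω bad (F \ nb e)).filter (bad e)).card := by
      exact_mod_cast card_le_card (filter_subset_filter _ (avoiding_anti Ω bad sdiff_subset))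
    have h1 := hind e he (F \ nb e) (sdiff_subset.trans hF) sdiff_disjoint
    have h2 : (1 - 2 * p * d) * ((avoiding Ω bad (F \ nb e)).card : ℝ) ≤
        (avoiding Ω bad F).card := by
      refine one_sub_mul_card_avoiding_le hp
        ((card_le_card (inter_subset_inter_right hF)).trans (hd e he)) fun f hf => ?_
      refine ih _ ?_ (F \ nb e) (sdiff_subset.trans hF) f (hF (mem_inter.mp hf).1) rfl
      rw [← hn]
      refine card_lt_card (ssubset_of_subset_not_subset sdiff_subset fun hsub => ?_)
      exact (mem_sdiff.mp (hsub (mem_inter.mp hf).1)).2 (mem_inter.mp hf).2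
    have h3 : (1 / 2 : ℝ) * ((avoiding Ω bad (F \ nb e)).card : ℝ) ≤
        (1 - 2 * p * d) * ((avoiding Ω bad (F \ nb e)).card : ℝ) :=
      mul_le_mul_of_nonneg_right (by linarith) (by positivity)
    have h4 : p * ((1 / 2 : ℝ) * ((avoiding Ω bad (F \ nb e)).card : ℝ)) ≤
        p * (avoiding Ω bad F).card := mul_le_mul_of_nonneg_left (h3.trans h2) hp
    linarith

end LocalLemma

/-! ### Product spaces of colourings: independence and local uniformity. -/

section ProductSpace

variable {ι C I : Type*} [Fintype ι] [DecidableEq ι]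

/-- Events depending on complementary sets of coordinates are independent under a product law. -/
theorem card_filter_and_mul_le (L : ι → Finset C) (T : Finset ι) (P Q : (ι → C) → Prop)
    [DecidablePred P] [DecidablePred Q]
    (hP : ∀ x y, (∀ i ∈ T, x i = y i) → P x → P y)
    (hQ : ∀ x y, (∀ i ∉ T, x i = y i) → Q x → Q y) :
    (((Fintype.piFinset L).filter Q).filter P).card * (Fintype.piFinset L).card ≤
      ((Fintype.piFinset L).filter P).card * ((Fintype.piFinset L).filter Q).card := by
  rw [← card_product, ← card_product]
  -- Exchanging the `T`-coordinates of a pair (x, y) is injective. If x satisfies both events, the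
  -- first new point inherits `P` from x on `T`, and the second inherits `Q` from x off `T`.
  let mix : (ι → C) → (ι → C) → ι → C := fun x y i => if i ∈ T then x i else y i
  have hmix : ∀ x ∈ Fintype.piFinset L, ∀ y ∈ Fintype.piFinset L,
      mix x y ∈ Fintype.piFinset L := by
    intro x hx y hy
    rw [Fintype.mem_piFinset] at *
    intro i
    simp only [mix]
    split_ifs
    exacts [hx i, hy i]
  refine card_le_card_of_injOn (fun z => (mix z.1 z.2, mix z.2 z.1)) ?_ ?_
  · rintro ⟨x, y⟩ hz
    simp only [coe_product, Set.mem_prod, mem_coe, mem_filter] at hz ⊢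
    obtain ⟨⟨⟨hx, hQx⟩, hPx⟩, hy⟩ := hz
    refine ⟨⟨hmix x hx y hy, hP x _ (fun i hi => ?_) hPx⟩,
      ⟨hmix y hy x hx, hQ x _ (fun i hi => ?_) hQx⟩⟩
    · simp [mix, hi]
    · simp [mix, hi]
  · rintro ⟨x, y⟩ - ⟨x', y'⟩ - heq
    simp only [Prod.mk.injEq] at heq ⊢
    constructor <;> funext i
    · have h1 := congrFun heq.1 i
      have h2 := congrFun heq.2 i
      simp only [mix] at h1 h2
      split_ifs at h1 h2
      exacts [h1, h2]
    · have h1 := congrFun heq.1 i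
      have h2 := congrFun heq.2 i
      simp only [mix] at h1 h2
      split_ifs at h1 h2
      exacts [h2, h1]

theorem card_filter_and_le (L : ι → Finset C) (hL : ∀ i, (L i).Nonempty) (T : Finset ι)
    (P Q : (ι → C) → Prop) [DecidablePred P] [DecidablePred Q] (hP : ∀ x y, (∀ i ∈ T, x i = y i) → P x → P y)
    (hQ : ∀ x y, (∀ i ∉ T, x i = y i) → Q x → Q y) {p : ℝ}
    (hp : (((Fintype.piFinset L).filter P).card : ℝ) ≤ p * (Fintype.piFinset L).card) :
    ((((Fintype.piFinset L).filter Q).filter P).card : ℝ) ≤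
      p * ((Fintype.piFinset L).filter Q).card := by
  have hpos : (0 : ℝ) < (Fintype.piFinset L).card := by
    exact_mod_cast (Fintype.piFinset_nonempty.mpr hL).card_pos
  have h : ((((Fintype.piFinset L).filter Q).filter P).card : ℝ) * (Fintype.piFinset L).card ≤
      ((Fintype.piFinset L).filter P).card * ((Fintype.piFinset L).filter Q).card := by
    exact_mod_cast card_filter_and_mul_le L T P Q hP hQ
  have h' : (((Fintype.piFinset L).filter P).card : ℝ) * ((Fintype.piFinset L).filter Q).card ≤
      p * (Fintype.piFinset L).card * ((Fintype.piFinset L).filter Q).card :=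
    mul_le_mul_of_nonneg_right hp (by positivity)
  refine le_of_mul_le_mul_right ?_ hpos
  linarith

/-- The colouring `x` is constant on `T`. -/
def MonoOn (T : Finset ι) (x : ι → C) : Prop := ∀ i ∈ T, ∀ j ∈ T, x i = x j

/-- The coordinate `t` remembers the common colour, so the coordinates in `T'` can be overwritten
without loss of information; each of them had at least `b` choices. -/
theorem card_monoOn_le (L : ι → Finset C) {T T' : Finset ι} {t : ι} {b : ℕ}
    (hT' : T' ⊆ T) (ht : t ∈ T) (htT' : t ∉ T') (hb : 1 ≤ b) (hLb : ∀ i ∈ T', b ≤ (L i).card) :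
    (((Fintype.piFinset L).filter (MonoOn T)).card : ℝ) ≤
      1 / (b : ℝ) ^ T'.card * (Fintype.piFinset L).card := by
  have hbpos : (0 : ℝ) < (b : ℝ) ^ T'.card := by positivity
  rw [one_div, inv_mul_eq_div, le_div_iff₀ hbpos]
  by_cases hne : Nonempty C
  · obtain ⟨c⟩ := hne
    have h1 : ((Fintype.piFinset L).filter (MonoOn T)).card ≤
        (Fintype.piFinset fun i => if i ∈ T' then {c} else L i).card := by
      refine card_le_card_of_injOn (fun x i => if i ∈ T' then c else x i) ?_ ?_
      · intro x hx
        have hx := (mem_filter.mp (mem_coe.mp hx)).1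
        rw [Fintype.mem_piFinset] at hx
        rw [mem_coe, Fintype.mem_piFinset]
        intro i
        by_cases hi : i ∈ T' <;> simp [hi, hx i]
      · intro x hx y hy heq
        have hx := (mem_filter.mp (mem_coe.mp hx)).2
        have hy := (mem_filter.mp (mem_coe.mp hy)).2
        have htt : x t = y t := by simpa [htT'] using congrFun heq t
        funext i
        by_cases hi : i ∈ T'
        · rw [hx i (hT' hi) t ht, hy i (hT' hi) t ht, htt]
        · simpa [hi] using congrFun heq i
    have h2 : (Fintype.piFinset fun i => if i ∈ T' then {c} else L i).card * b ^ T'.card ≤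
        (Fintype.piFinset L).card := by
      have h3 : b ^ T'.card = ∏ i : ι, if i ∈ T' then b else 1 := by simp [prod_ite_mem]
      rw [Fintype.card_piFinset, Fintype.card_piFinset, h3, ← prod_mul_distrib]
      refine prod_le_prod' fun i _ => ?_
      by_cases hi : i ∈ T'
      · simpa [hi] using hLb i hi
      · simp [hi]
    exact_mod_cast (Nat.mul_le_mul_right _ h1).trans h2
  · have : IsEmpty C := not_nonempty_iff.mp hne
    have : IsEmpty (ι → C) := ⟨fun x => IsEmpty.false (x t)⟩
    simp [Finset.eq_empty_of_isEmpty]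

theorem card_filter_apply_mem [DecidableEq C] (L : ι → Finset C) (v : ι) (A : Finset C) :
    ((Fintype.piFinset L).filter fun x => x v ∈ A).card * (L v).card =
      (L v ∩ A).card * (Fintype.piFinset L).card := by
  have h : (Fintype.piFinset L).filter (fun x => x v ∈ A) =
      Fintype.piFinset (Function.update L v (L v ∩ A)) := by
    ext x
    simp only [mem_filter, Fintype.mem_piFinset]
    constructor
    · rintro ⟨hx, hv⟩ i
      by_cases hi : i = v
      · subst hi; simpa using ⟨hx i, hv⟩
      · simpa [hi] using hx i
    · intro hx
      have hv := hx v
      simp only [Function.update_self, mem_inter] at hv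
      refine ⟨fun i => ?_, hv.2⟩
      by_cases hi : i = v
      · subst hi; exact hv.1
      · simpa [hi] using hx i
  rw [h, Fintype.card_piFinset, Fintype.card_piFinset,
    ← mul_prod_erase univ (fun i => (L i).card) (mem_univ v),
    ← mul_prod_erase univ (fun i => (Function.update L v (L v ∩ A) i).card) (mem_univ v)]
  have : ∏ i ∈ univ.erase v, (Function.update L v (L v ∩ A) i).card =
      ∏ i ∈ univ.erase v, (L i).card :=
    prod_congr rfl fun i hi => by rw [Function.update_of_ne (ne_of_mem_erase hi)]
  rw [this, Function.update_self]
  ring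

/-- Local uniformity: conditioning on properness hardly increases the law of one colour. -/
theorem card_proper_apply_mem_le [DecidableEq C] (L : ι → Finset C) (hL : ∀ i, (L i).Nonempty)
    (E : Finset I) (vs : I → Finset ι) {k Δ b : ℕ} (v : ι) (A : Finset C)
    (hk : ∀ e ∈ E, (vs e).card = k) (hk2 : 2 ≤ k)
    (hΔ : ∀ u, (E.filter fun f => u ∈ vs f).card ≤ Δ)
    (hb : 1 ≤ b) (hLb : ∀ i, i ≠ v → b ≤ (L i).card)
    (hLLL : 4 * (1 / (b : ℝ) ^ (k - 2) * (k * Δ : ℕ)) ≤ 1) :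
    (1 - 2 * (1 / (b : ℝ) ^ (k - 2)) * Δ) *
        (((avoiding (Fintype.piFinset L) (fun e => MonoOn (vs e)) E).filter
          fun x => x v ∈ A).card : ℝ) ≤
      (L v ∩ A).card / (L v).card *
        (avoiding (Fintype.piFinset L) (fun e => MonoOn (vs e)) E).card := by
  set Ω := Fintype.piFinset L with hΩ
  set bad : I → (ι → C) → Prop := fun e => MonoOn (vs e) with hbad
  set p : ℝ := 1 / (b : ℝ) ^ (k - 2) with hp
  have hp0 : 0 ≤ p := by positivity
  -- The exponent is k - 2 because `v`, whose list need not be large, is left out, and one further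
  -- vertex t serves as the reference colour.
  have hmono : ∀ e ∈ E, ((Ω.filter (bad e)).card : ℝ) ≤ p * Ω.card := by
    intro e he
    have hc : k - 1 ≤ ((vs e).erase v).card := by
      have := pred_card_le_card_erase (s := vs e) (a := v)
      rw [hk e he] at this
      exact this
    have hne : ((vs e).erase v).Nonempty := card_pos.mp (by omega)
    obtain ⟨t, ht⟩ := hne
    obtain ⟨T', hT', hcard⟩ := exists_subset_card_eq (s := ((vs e).erase v).erase t) (n := k - 2)
      (by rw [card_erase_of_mem ht]; omega)
    have := card_monoOn_le L (T := vs e) (T' := T') (t := t) (b := b)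
      (hT'.trans ((erase_subset _ _).trans (erase_subset _ _))) (mem_of_mem_erase ht)
      (fun h => notMem_erase t _ (hT' h)) hb
      (fun i hi => hLb i (ne_of_mem_erase (mem_of_mem_erase (hT' hi))))
    rwa [hcard] at this
  have hdep : ∀ F : Finset I, ∀ T : Finset ι, (∀ f ∈ F, Disjoint (vs f) T) → ∀ x y : ι → C,
      (∀ i ∉ T, x i = y i) → (∀ f ∈ F, ¬ bad f x) → ∀ f ∈ F, ¬ bad f y := by
    intro F T hF x y hxy hx f hf hy
    refine hx f hf fun i hi j hj => ?_
    rw [hxy i (disjoint_left.mp (hF f hf) hi), hxy j (disjoint_left.mp (hF f hf) hj)]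
    exact hy i hi j hj
  have hLL := card_bad_avoiding_le (Ω := Ω) (bad := bad) (E := E)
    (nb := fun e => E.filter fun f => ¬ Disjoint (vs f) (vs e)) hp0 hLLL
    (by
      intro e he
      calc _ ≤ ((vs e).biUnion fun u => E.filter fun f => u ∈ vs f).card := by
            refine card_le_card fun f hf => ?_
            obtain ⟨hfE, hf⟩ := mem_filter.mp (mem_inter.mp hf).2
            obtain ⟨u, huf, hue⟩ := not_disjoint_iff.mp hf
            exact mem_biUnion.mpr ⟨u, hue, mem_filter.mpr ⟨hfE, huf⟩⟩
        _ ≤ (vs e).card * Δ := card_biUnion_le_card_mul _ _ _ fun u _ => hΔ u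
        _ = k * Δ := by rw [hk e he])
    (by
      intro e he F hF hdis
      refine card_filter_and_le L hL (vs e) (bad e) _ ?_ (hdep F (vs e) ?_) (hmono e he)
      · intro x y hxy hx i hi j hj
        rw [← hxy i hi, ← hxy j hj]
        exact hx i hi j hj
      · intro f hf
        by_contra h
        exact disjoint_left.mp hdis hf (mem_filter.mpr ⟨hF hf, h⟩))
  -- Without the hyperedges through `v`, the coordinate `v` is independent of the remaining
  -- constraints. Restoring them keeps at least a fraction 1 - 2pΔ of the colourings.
  set M := E.filter fun f => v ∈ vs f with hM
  have hEM : E ∩ M = M := inter_eq_right.mpr (filter_subset _ _)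
  have h1 : (1 - 2 * p * Δ) * ((avoiding Ω bad (E \ M)).card : ℝ) ≤ (avoiding Ω bad E).card := by
    refine one_sub_mul_card_avoiding_le hp0 ?_ fun f hf => hLL _ sdiff_subset f (mem_inter.mp hf).1
    rw [hEM]
    exact hΔ v
  have h2 : (((avoiding Ω bad (E \ M)).filter fun x => x v ∈ A).card : ℝ) ≤
      (L v ∩ A).card / (L v).card * (avoiding Ω bad (E \ M)).card := by
    refine card_filter_and_le L hL {v} (fun x => x v ∈ A) _ ?_ (hdep (E \ M) {v} ?_) ?_
    · intro x y hxy hx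
      rwa [← hxy v (mem_singleton_self v)]
    · intro f hf
      rw [disjoint_singleton_right]
      intro hv
      exact (mem_sdiff.mp hf).2 (mem_filter.mpr ⟨(mem_sdiff.mp hf).1, hv⟩)
    · have hpos : (0 : ℝ) < (L v).card := by exact_mod_cast (hL v).card_pos
      rw [div_mul_eq_mul_div, le_div_iff₀ hpos]
      exact_mod_cast (card_filter_apply_mem L v A).le
  have h3 : (((avoiding Ω bad E).filter fun x => x v ∈ A).card : ℝ) ≤
      ((avoiding Ω bad (E \ M)).filter fun x => x v ∈ A).card := by
    exact_mod_cast card_le_card (filter_subset_filter _ (avoiding_anti Ω bad sdiff_subset))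
  have hfac : 0 ≤ 1 - 2 * p * Δ := by
    have hkΔ : p * (Δ : ℝ) ≤ p * (k * Δ : ℕ) := mul_le_mul_of_nonneg_left
      (by exact_mod_cast Nat.le_mul_of_pos_left Δ (by omega)) hp0
    linarith
  calc _ ≤ (1 - 2 * p * Δ) * ((L v ∩ A).card / (L v).card * (avoiding Ω bad (E \ M)).card) :=
        mul_le_mul_of_nonneg_left (h3.trans h2) hfac
    _ = (L v ∩ A).card / (L v).card * ((1 - 2 * p * Δ) * (avoiding Ω bad (E \ M)).card) := by ring
    _ ≤ _ := mul_le_mul_of_nonneg_left h1 (by positivity)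

end ProductSpace

/-! ### Random configurations -/

theorem toOuterMeasure_le_one {β : Type*} (D : PMF β) (S : Set β) : D.toOuterMeasure S ≤ 1 := by
  rw [← (D.toOuterMeasure_apply_eq_one_iff (s := Set.univ)).mpr (Set.subset_univ _)]
  exact D.toOuterMeasure.mono (Set.subset_univ S)

section Monochromatic

variable {V I : Type*} {s : ℕ}

/-- If every partial configuration on `A` has probability at most `β ^ |A|`, then the probability
that disjoint sets of size `a` are all monochromatic is at most `(s β ^ a) ^ |W|`. -/
theorem toOuterMeasure_forall_monoOn_le (D : PMF (V → Fin s)) {β : ℝ≥0∞}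
    (hD : ∀ (A : Finset V) (σ : V → Fin s), D.toOuterMeasure {Y | ∀ u ∈ A, Y u = σ u} ≤ β ^ A.card)
    {a : ℕ} (ha : 1 ≤ a) (T : I → Finset V) (W : Finset I) (hT : ∀ e ∈ W, (T e).card = a)
    (hdis : ∀ e ∈ W, ∀ f ∈ W, e ≠ f → Disjoint (T e) (T f)) :
    D.toOuterMeasure {Y | ∀ e ∈ W, MonoOn (T e) Y} ≤ (s * β ^ a) ^ W.card := by
  -- For the induction, values on a further set `A` are prescribed too. Peeling off a hyperedge is a
  -- union over its s possible values, each of which turns its set into prescribed vertices.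
  suffices h : ∀ (A : Finset V) (σ : V → Fin s), (∀ e ∈ W, Disjoint A (T e)) →
      D.toOuterMeasure {Y | (∀ u ∈ A, Y u = σ u) ∧ ∀ e ∈ W, MonoOn (T e) Y} ≤
        β ^ A.card * (s * β ^ a) ^ W.card by
    rcases isEmpty_or_nonempty (V → Fin s) with hne | ⟨⟨σ⟩⟩
    · have : {Y : V → Fin s | ∀ e ∈ W, MonoOn (T e) Y} = ∅ := Set.eq_empty_of_isEmpty _
      rw [this]
      simp
    · simpa using h ∅ σ (by simp)
  induction W using Finset.induction_on with
  | empty => intro A σ _; simpa using hD A σ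
  | insert e W heW ih =>
    intro A σ hA
    have hTe : (T e).card = a := hT e (mem_insert_self _ _)
    obtain ⟨t, ht⟩ : (T e).Nonempty := card_pos.mp (by omega)
    have hAe : Disjoint A (T e) := hA e (mem_insert_self _ _)
    have hsub : {Y : V → Fin s | (∀ u ∈ A, Y u = σ u) ∧ ∀ f ∈ insert e W, MonoOn (T f) Y} ⊆
        ⋃ j : Fin s, {Y | (∀ u ∈ A ∪ T e, Y u = if u ∈ A then σ u else j) ∧
          ∀ f ∈ W, MonoOn (T f) Y} := by
      rintro Y ⟨hYA, hY⟩
      refine Set.mem_iUnion.mpr ⟨Y t, fun u hu => ?_, fun f hf => hY f (mem_insert_of_mem hf)⟩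
      by_cases huA : u ∈ A
      · rw [if_pos huA, hYA u huA]
      · rw [if_neg huA]
        exact hY e (mem_insert_self _ _) u ((mem_union.mp hu).resolve_left huA) t ht
    calc _ ≤ _ := D.toOuterMeasure.mono hsub
      _ ≤ ∑ j : Fin s, D.toOuterMeasure {Y | (∀ u ∈ A ∪ T e, Y u = if u ∈ A then σ u else j) ∧
          ∀ f ∈ W, MonoOn (T f) Y} := MeasureTheory.measure_iUnion_fintype_le _ _
      _ ≤ ∑ _j : Fin s, β ^ (A ∪ T e).card * (s * β ^ a) ^ W.card := by
          refine sum_le_sum fun j _ => ?_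
          refine ih (fun f hf => hT f (mem_insert_of_mem hf))
            (fun f hf g hg => hdis f (mem_insert_of_mem hf) g (mem_insert_of_mem hg)) _ _ ?_
          intro f hf
          rw [disjoint_union_left]
          exact ⟨hA f (mem_insert_of_mem hf), hdis e (mem_insert_self _ _) f
            (mem_insert_of_mem hf) (fun h => heW (h ▸ hf))⟩
      _ = β ^ A.card * (s * β ^ a) ^ (insert e W).card := by
          rw [card_union_of_disjoint hAe, hTe, card_insert_of_notMem heW, sum_const, card_univ,
            Fintype.card_fin, nsmul_eq_mul]
          ring

end Monochromatic

/-! ### Rejection sampling preserves conditional bounds. -/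

section Sampler

variable {n q s : ℕ}

theorem natCast_div_le_ofReal {a b : ℕ} {c : ℝ} (hc : 0 ≤ c) (h : (a : ℝ) ≤ c * b) :
    (a : ℝ≥0∞) / b ≤ ENNReal.ofReal c := by
  refine ENNReal.div_le_of_le_mul ?_
  rw [← ENNReal.ofReal_natCast a, ← ENNReal.ofReal_natCast b, ← ENNReal.ofReal_mul hc]
  exact ENNReal.ofReal_le_ofReal h

/-- Rejection sampling: if conditioning one trial on success bounds the event `A` by `c`, then an
event that holds with probability at most `c` after rejection, and otherwise only if `A` does, has
probability at most `c`. -/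
theorem toOuterMeasure_rejSample_bind_le (G : Hypergraph (Fin n)) (h : ProjectionScheme q s)
    {Λ : Finset (Fin n)} (Y : Λ → Fin s) {β : Type*} (f : Option (G.vertexSet → Fin q) → PMF β)
    (S : Set β) (A : Set (G.vertexSet → Fin q)) {c : ℝ≥0∞}
    (hnone : (f none).toOuterMeasure S ≤ c)
    (hsome : ∀ X ∉ A, (f (some X)).toOuterMeasure S = 0)
    (hA : (drawColouring G h Y).toOuterMeasure {X | IsProper G X ∧ X ∈ A} ≤
      c * (drawColouring G h Y).toOuterMeasure {X | IsProper G X}) (R : ℕ) :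
    ((rejSample G h Y R).bind f).toOuterMeasure S ≤ c := by
  induction R with
  | zero => rwa [rejSample, PMF.pure_bind]
  | succ R ih =>
    rw [rejSample, PMF.bind_bind, PMF.toOuterMeasure_bind_apply]
    rw [PMF.toOuterMeasure_apply, PMF.toOuterMeasure_apply] at hA
    set D := drawColouring G h Y
    -- A proper trial contributes at most c Pr[proper] by `hA`; an improper one leads to the
    -- remaining trials and contributes at most c Pr[improper] by induction.
    calc _ ≤ ∑' X, ({X | IsProper G X ∧ X ∈ A}.indicator D X +
          c * {X | ¬ IsProper G X}.indicator D X) := by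
          refine ENNReal.tsum_le_tsum fun X => ?_
          by_cases hX : IsProper G X
          · by_cases hXA : X ∈ A
            · simp only [hX, if_true, PMF.pure_bind]
              simp only [Set.indicator, Set.mem_ofPred_eq, hX, hXA]
              simp only [and_self, if_true, not_true_eq_false, if_false, mul_zero, add_zero]
              refine mul_le_of_le_one_right' ?_
              exact toOuterMeasure_le_one _ _
            · simp [hX, PMF.pure_bind, hsome X hXA]
          · simp only [hX, if_false, Set.indicator, Set.mem_ofPred_eq, false_and, not_false_eq_true,
              if_true, zero_add]
            rw [mul_comm]
            exact mul_le_mul_left ih _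
      _ = ∑' X, {X | IsProper G X ∧ X ∈ A}.indicator D X +
          c * ∑' X, {X | ¬ IsProper G X}.indicator D X := by
          rw [ENNReal.tsum_add, ENNReal.tsum_mul_left]
      _ ≤ c * ∑' X, {X | IsProper G X}.indicator D X +
          c * ∑' X, {X | ¬ IsProper G X}.indicator D X := add_le_add_left hA _
      _ = c * ∑' X, D X := by
          rw [← mul_add, ← ENNReal.tsum_add]
          congr 2
          funext X
          by_cases hX : IsProper G X <;> simp [Set.indicator, hX]
      _ = c := by rw [D.tsum_coe, mul_one]

end Sampler

/-! ### Local uniformity of `Sample` and its propagation along the scan. -/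

section Sampler

variable {n q s : ℕ}

/-- The hyperedges of `H` as a finset. -/
noncomputable def edges (H : Hypergraph (Fin n)) : Finset (Set (Fin n)) :=
  univ.filter fun e => e ∈ H.edgeSet

/-- The vertices of a hyperedge as a finset. -/
noncomputable def verts (e : Set (Fin n)) : Finset (Fin n) := univ.filter fun v => v ∈ e

@[simp] theorem mem_edges {H : Hypergraph (Fin n)} {e : Set (Fin n)} :
    e ∈ edges H ↔ e ∈ H.edgeSet := by simp [edges]

@[simp] theorem mem_verts {e : Set (Fin n)} {v : Fin n} : v ∈ verts e ↔ v ∈ e := by simp [verts]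

theorem coe_verts (e : Set (Fin n)) : (verts e : Set (Fin n)) = e := by ext; simp

theorem card_verts {H : Hypergraph (Fin n)} {k : ℕ} (hunif : IsUniform H k) :
    ∀ e ∈ edges H, (verts e).card = k := fun e he => by
  rw [← hunif e (mem_edges.mp he), ← Set.ncard_coe_finset, coe_verts]

theorem card_edges_through_le (H : Hypergraph (Fin n)) (v : Fin n) :
    ((edges H).filter fun f => v ∈ verts f).card ≤ maxDegree H := by
  have h : ((edges H).filter fun f => v ∈ verts f).card = degree H v := by
    rw [degree, ← Set.ncard_coe_finset]
    congr 1
    ext f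
    simp
  rw [h]
  exact le_sup (f := degree H) (mem_univ v)

theorem isProper_iff {α : Type*} (G : Hypergraph (Fin n)) (X : G.vertexSet → α) :
    IsProper G X ↔ ∀ e ∈ edges G, ¬ MonoOn (univ.filter fun w : G.vertexSet => (w : Fin n) ∈ e) X := by
  simp only [IsProper, mem_edges, MonoOn, mem_filter, mem_univ, true_and]
  refine forall₂_congr fun e _ => ?_
  push Not
  simp only [exists_and_left]

theorem componentsMeeting_singleton (G : Hypergraph (Fin n)) (v : Fin n) :
    componentsMeeting G {v} = [component G v] := by
  simp [componentsMeeting]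

/-- One trial of the rejection sampler is locally uniform. -/
theorem drawColouring_proper_le (H : Hypergraph (Fin n)) {k : ℕ} (hunif : IsUniform H k)
    (hk2 : 2 ≤ k) (h : ProjectionScheme q s) {b : ℕ} (hb : 1 ≤ b)
    (hbucket : ∀ j, b ≤ (h.bucket j).card)
    (hLLL : 4 * (1 / (b : ℝ) ^ (k - 2) * (k * maxDegree H : ℕ)) ≤ 1) (G : Hypergraph (Fin n))
    (hG : G.edgeSet ⊆ H.edgeSet) (v : Fin n) (hv : v ∈ G.vertexSet)
    (Y : (({v} : Finset (Fin n))ᶜ : Finset (Fin n)) → Fin s) (j : Fin s) {c : ℝ} (hc0 : 0 ≤ c)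
    (hc : ((h.bucket j).card : ℝ) / q ≤ c * (1 - 2 * (1 / (b : ℝ) ^ (k - 2)) * maxDegree H)) :
    (drawColouring G h Y).toOuterMeasure {X | IsProper G X ∧ X ∈ {X | h.toFun (X ⟨v, hv⟩) = j}} ≤
      ENNReal.ofReal c * (drawColouring G h Y).toOuterMeasure {X | IsProper G X} := by
  set p : ℝ := 1 / (b : ℝ) ^ (k - 2) with hp
  have hp0 : 0 ≤ p := by positivity
  have hfac : 0 < 1 - 2 * p * maxDegree H := by
    have hkΔ : p * (maxDegree H : ℝ) ≤ p * (k * maxDegree H : ℕ) := mul_le_mul_of_nonneg_left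
      (by exact_mod_cast Nat.le_mul_of_pos_left _ (by omega)) hp0
    linarith
  have key := card_proper_apply_mem_le (fun w : G.vertexSet => colourList h Y w)
    (fun w => colourList_nonempty h Y w) (edges G)
    (fun e => univ.filter fun w : G.vertexSet => (w : Fin n) ∈ e) (k := k) (Δ := maxDegree H) (b := b)
    ⟨v, hv⟩ (h.bucket j)
    (by
      intro e he
      rw [← card_verts hunif e (mem_edges.mpr (hG (mem_edges.mp he)))]
      rw [← card_map (Function.Embedding.subtype _)]
      congr 1
      ext w
      simp only [mem_map, mem_filter, mem_univ, true_and, Function.Embedding.subtype_apply,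
        Subtype.exists, exists_and_left, exists_prop, exists_eq_right_right, mem_verts]
      exact ⟨fun hw => hw.1, fun hw => ⟨hw, G.subset_vertexSet_of_mem_edgeSet (mem_edges.mp he) hw⟩⟩)
    hk2
    (by
      intro u
      refine le_trans (card_le_card fun f hf => ?_) (card_edges_through_le H u)
      simp only [mem_filter, mem_edges, mem_univ, true_and, mem_verts] at hf ⊢
      exact ⟨hG hf.1, hf.2⟩)
    hb
    (by
      intro w hw
      have hwv : (w : Fin n) ∈ (({v} : Finset (Fin n))ᶜ : Finset (Fin n)) := by
        simp only [mem_compl, mem_singleton]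
        exact fun h' => hw (Subtype.ext h')
      simp only [colourList, hwv, dif_pos]
      exact hbucket _)
    hLLL
  -- The vertex `v` lies outside the domain of `Y`, so its unconditioned share of bucket `j` is
  -- |h⁻¹(j)|/q.
  have hLv : colourList h Y v = univ := by simp [colourList]
  simp only [hLv, univ_inter, card_univ, Fintype.card_fin] at key
  rw [drawColouring, PMF.toOuterMeasure_uniformOfFinset_apply,
    PMF.toOuterMeasure_uniformOfFinset_apply, ← mul_div_assoc]
  refine ENNReal.div_le_div_right ?_ _
  rw [← ENNReal.ofReal_natCast, ← ENNReal.ofReal_natCast, ← ENNReal.ofReal_mul hc0]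
  refine ENNReal.ofReal_le_ofReal ?_
  have e1 : ∀ (Ω : Finset (G.vertexSet → Fin q)) (_ : DecidablePred fun X : G.vertexSet → Fin q => X ∈ {X | IsProper G X}),
      Ω.filter (fun X => X ∈ {X | IsProper G X}) =
      avoiding Ω (fun e => MonoOn (univ.filter fun w : G.vertexSet => (w : Fin n) ∈ e)) (edges G) := by
    intro Ω _
    ext X
    simp only [avoiding, mem_filter, Set.mem_ofPred_eq, isProper_iff]
  have e2 : ∀ (Ω : Finset (G.vertexSet → Fin q)) (_ : DecidablePred fun X : G.vertexSet → Fin q =>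
        X ∈ {X | IsProper G X ∧ X ∈ {X | h.toFun (X ⟨v, hv⟩) = j}}),
      Ω.filter (fun X => X ∈ {X | IsProper G X ∧ X ∈ {X | h.toFun (X ⟨v, hv⟩) = j}}) =
      (avoiding Ω (fun e => MonoOn (univ.filter fun w : G.vertexSet => (w : Fin n) ∈ e))
        (edges G)).filter fun X => X ⟨v, hv⟩ ∈ h.bucket j := by
    intro Ω _
    ext X
    simp only [avoiding, mem_filter, Set.mem_ofPred_eq, isProper_iff, ProjectionScheme.bucket,
      mem_univ, true_and, and_assoc]
  rw [e1, e2]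
  have h2 := key.trans (mul_le_mul_of_nonneg_right hc (by positivity))
  refine le_of_mul_le_mul_left ?_ hfac
  linarith

/-- The projected output of the uniform fallback of `Sample`. -/
theorem uniformColouring_apply_le (h : ProjectionScheme q s) (v : Fin n) (j : Fin s) {c : ℝ}
    (hc0 : 0 ≤ c) (hc : ((h.bucket j).card : ℝ) / q ≤ c) :
    (uniformColouring h {v}).toOuterMeasure
      {X | h.toFun (X ⟨v, mem_singleton_self v⟩) = j} ≤ ENNReal.ofReal c := by
  have := h.nonempty_colours
  rw [uniformColouring, PMF.uniformOfFintype, PMF.toOuterMeasure_uniformOfFinset_apply]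
  refine natCast_div_le_ofReal hc0 ?_
  have hq : (0 : ℝ) < q := by exact_mod_cast lt_of_lt_of_le h.one_le h.le
  have key := card_filter_apply_mem (fun _ : ({v} : Finset (Fin n)) => (univ : Finset (Fin q)))
    ⟨v, mem_singleton_self v⟩ (h.bucket j)
  rw [Fintype.piFinset_univ, univ_inter, card_univ (α := Fin q), Fintype.card_fin] at key
  have e : ∀ (_ : DecidablePred fun X => X ∈ {X : ({v} : Finset (Fin n)) → Fin q |
        h.toFun (X ⟨v, mem_singleton_self v⟩) = j}),
      (univ : Finset (({v} : Finset (Fin n)) → Fin q)).filter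
      (fun X => X ∈ {X : ({v} : Finset (Fin n)) → Fin q |
        h.toFun (X ⟨v, mem_singleton_self v⟩) = j}) =
      univ.filter fun X => X ⟨v, mem_singleton_self v⟩ ∈ h.bucket j := by
    intro _
    ext X
    simp [ProjectionScheme.bucket]
  rw [e]
  have key' : ((univ.filter fun X : ({v} : Finset (Fin n)) → Fin q =>
      X ⟨v, mem_singleton_self v⟩ ∈ h.bucket j).card : ℝ) * q = (h.bucket j).card *
        (univ : Finset (({v} : Finset (Fin n)) → Fin q)).card := by exact_mod_cast key
  rw [div_le_iff₀ hq] at hc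
  have := mul_le_mul_of_nonneg_right hc
    (Nat.cast_nonneg (α := ℝ) (univ : Finset (({v} : Finset (Fin n)) → Fin q)).card)
  refine le_of_mul_le_mul_right ?_ hq
  linarith

/-- A single-vertex call of `Sample` puts mass at most `c` on every bucket. -/
theorem sample_singleton_le (H : Hypergraph (Fin n)) {k : ℕ} (hunif : IsUniform H k)
    (hk2 : 2 ≤ k) (h : ProjectionScheme q s) {b : ℕ} (hb : 1 ≤ b)
    (hbucket : ∀ j, b ≤ (h.bucket j).card)
    (hLLL : 4 * (1 / (b : ℝ) ^ (k - 2) * (k * maxDegree H : ℕ)) ≤ 1) (v : Fin n)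
    (Y : (({v} : Finset (Fin n))ᶜ : Finset (Fin n)) → Fin s) (ζ : ℝ) (j : Fin s) {c : ℝ}
    (hc0 : 0 ≤ c)
    (hc : ((h.bucket j).card : ℝ) / q ≤ c * (1 - 2 * (1 / (b : ℝ) ^ (k - 2)) * maxDegree H)) :
    (sample H k h {v} Y ζ).toOuterMeasure
      {r | h.toFun (r.2 ⟨v, mem_singleton_self v⟩) = j} ≤ ENNReal.ofReal c := by
  -- The bound without the local lemma factor, for the two uniform fallbacks.
  have hc' : ((h.bucket j).card : ℝ) / q ≤ c := by
    refine hc.trans (mul_le_of_le_one_right hc0 ?_)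
    have : (0 : ℝ) ≤ 2 * (1 / (b : ℝ) ^ (k - 2)) * maxDegree H := by positivity
    linarith
  have hunifc := uniformColouring_apply_le h v j hc0 hc'
  rw [sample]
  split_ifs
  · rw [PMF.toOuterMeasure_map_apply]
    exact hunifc
  · rw [componentsMeeting_singleton, colourComponents.eq_def, PMF.bind_bind]
    have hv : v ∈ (component (prune H Y) v).vertexSet := Relation.ReflTransGen.refl
    refine toOuterMeasure_rejSample_bind_le _ h Y _ _ {X | h.toFun (X ⟨v, hv⟩) = j} ?_ ?_
      (drawColouring_proper_le H hunif hk2 h hb hbucket hLLL (component (prune H Y) v)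
        (fun e he => he.1.1) v hv Y j hc0 hc) _
    · rw [PMF.pure_bind, PMF.toOuterMeasure_map_apply]
      exact hunifc
    · intro X hX
      simp only [colourComponents]
      rw [PMF.pure_bind, PMF.toOuterMeasure_pure_apply, if_neg]
      simpa [hv] using hX

/-- Every partial configuration on `A` has probability at most `β ^ |A|` at any time of the scan. -/
theorem scan_le [NeZero n] (H : Hypergraph (Fin n)) (k : ℕ) (h : ProjectionScheme q s) (ε : ℝ)
    {β : ℝ≥0∞} (hβ : (s : ℝ≥0∞)⁻¹ ≤ β)
    (hstep : ∀ (v : Fin n) (Y : (({v} : Finset (Fin n))ᶜ : Finset (Fin n)) → Fin s) (ζ : ℝ)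
      (j : Fin s), (sample H k h {v} Y ζ).toOuterMeasure
        {r | h.toFun (r.2 ⟨v, mem_singleton_self v⟩) = j} ≤ β)
    (t : ℕ) (A : Finset (Fin n)) (σ : Fin n → Fin s) :
    (scan H k h ε t).toOuterMeasure {Y | ∀ u ∈ A, Y u = σ u} ≤ β ^ A.card := by
  -- No stationarity is needed: `hstep` holds for every current configuration. If the updated vertex
  -- lies in `A` it contributes one factor β and `A.erase v` is handled by induction; otherwise the
  -- update does not affect the event.
  induction t generalizing A with
  | zero =>
    have := h.nonempty_buckets
    rw [scan, PMF.uniformOfFintype, PMF.toOuterMeasure_uniformOfFinset_apply]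
    refine le_trans ?_ (pow_le_pow_left' hβ _)
    have e : ∀ (_ : DecidablePred fun Y => Y ∈ {Y : Fin n → Fin s | ∀ u ∈ A, Y u = σ u}),
        (univ : Finset (Fin n → Fin s)).filter (fun Y => Y ∈ {Y : Fin n → Fin s |
        ∀ u ∈ A, Y u = σ u}) = Fintype.piFinset fun u => if u ∈ A then {σ u} else univ := by
      intro _
      ext Y
      simp only [mem_filter, mem_univ, true_and, Set.mem_ofPred_eq, Fintype.mem_piFinset]
      refine forall_congr' fun u => ?_
      by_cases hu : u ∈ A <;> simp [hu]
    have hcard : (Fintype.piFinset fun u : Fin n => if u ∈ A then {σ u} else (univ : Finset (Fin s))).card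
        * s ^ A.card = s ^ n := by
      have h3 : s ^ A.card = ∏ i : Fin n, if i ∈ A then s else 1 := by simp [prod_ite_mem]
      have h4 : s ^ n = ∏ _i : Fin n, s := by simp
      rw [Fintype.card_piFinset, h3, h4, ← prod_mul_distrib]
      refine prod_congr rfl fun i _ => ?_
      by_cases hi : i ∈ A <;> simp [hi]
    have hs0 : (s : ℝ≥0∞) ≠ 0 := by exact_mod_cast (show s ≠ 0 from by have := h.one_le; omega)
    rw [e, card_univ, Fintype.card_fun, Fintype.card_fin, Fintype.card_fin, ← hcard]
    refine ENNReal.div_le_of_le_mul ?_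
    push_cast
    rw [mul_comm, mul_assoc, ← mul_pow, ENNReal.mul_inv_cancel hs0 (ENNReal.natCast_ne_top s),
      one_pow, mul_one]
  | succ t ih =>
    rw [scan, PMF.toOuterMeasure_bind_apply]
    set v := scanVertex n (t + 1)
    have hind : ∀ B : Finset (Fin n), ∀ c : ℝ≥0∞,
        ∑' Y, scan H k h ε t Y * ({Y | ∀ u ∈ B, Y u = σ u}.indicator (fun _ => c) Y) ≤
          β ^ B.card * c := by
      intro B c
      refine le_trans (le_of_eq ?_) (mul_le_mul_left (ih B) c)
      rw [PMF.toOuterMeasure_apply, ← ENNReal.tsum_mul_right]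
      refine tsum_congr fun Y => ?_
      by_cases hY : ∀ u ∈ B, Y u = σ u
      · rw [Set.indicator_of_mem (by exact hY), Set.indicator_of_mem (by exact hY)]
      · rw [Set.indicator_of_notMem (by exact hY), Set.indicator_of_notMem (by exact hY), mul_zero,
          zero_mul]
    by_cases hv : v ∈ A
    · have hcard : β ^ A.card = β ^ (A.erase v).card * β := by
        rw [← pow_succ, card_erase_add_one hv]
      rw [hcard]
      refine le_trans (ENNReal.tsum_le_tsum fun Y => ?_) (hind (A.erase v) β)
      refine mul_le_mul_right ?_ _
      rw [PMF.toOuterMeasure_map_apply]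
      by_cases hY : ∀ u ∈ A.erase v, Y u = σ u
      · rw [Set.indicator_of_mem (by exact hY)]
        refine le_trans ((PMF.toOuterMeasure _).mono fun r hr => ?_) (hstep v _ _ (σ v))
        have : Function.update Y v (h.toFun (r.2 ⟨v, mem_singleton_self v⟩)) v = σ v := hr v hv
        rwa [Function.update_self] at this
      · have : ((fun r : SampleExit × (({v} : Finset (Fin n)) → Fin q) => Function.update Y v
            (h.toFun (r.2 ⟨v, mem_singleton_self v⟩))) ⁻¹' {Y | ∀ u ∈ A, Y u = σ u}) = ∅ := by
          refine Set.eq_empty_of_forall_notMem fun r hr => hY fun u hu => ?_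
          have : Function.update Y v (h.toFun (r.2 ⟨v, mem_singleton_self v⟩)) u = σ u :=
            hr u (mem_of_mem_erase hu)
          rwa [Function.update_of_ne (ne_of_mem_erase hu)] at this
        rw [this]
        simp
    · rw [← mul_one (β ^ A.card)]
      refine le_trans (ENNReal.tsum_le_tsum fun Y => ?_) (hind A 1)
      refine mul_le_mul_right ?_ _
      rw [PMF.toOuterMeasure_map_apply]
      by_cases hY : ∀ u ∈ A, Y u = σ u
      · rw [Set.indicator_of_mem (by exact hY)]
        exact toOuterMeasure_le_one _ _
      · have : ((fun r : SampleExit × (({v} : Finset (Fin n)) → Fin q) => Function.update Y v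
            (h.toFun (r.2 ⟨v, mem_singleton_self v⟩))) ⁻¹' {Y | ∀ u ∈ A, Y u = σ u}) = ∅ := by
          refine Set.eq_empty_of_forall_notMem fun r hr => hY fun u hu => ?_
          have : Function.update Y v (h.toFun (r.2 ⟨v, mem_singleton_self v⟩)) u = σ u := hr u hu
          rwa [Function.update_of_ne (ne_of_mem_of_not_mem hu hv)] at this
        rw [this]
        simp

end Sampler

/-! ### Large components -/

section Components

variable {n s : ℕ}

theorem component_edge_subset_of_mem {G : Hypergraph (Fin n)} {v u : Fin n} {f : Set (Fin n)}
    (hf : f ∈ G.edgeSet) (hu : u ∈ f) (hvu : Relation.ReflTransGen G.Adj v u) :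
    f ∈ (component G v).edgeSet :=
  ⟨hf, fun _ hw => hvu.tail ⟨f, hf, hu, hw⟩⟩

/-- If no hyperedge of `A` touched the rest, then along a walk from a vertex of `A` every vertex
would lie on a hyperedge of `A`; the walk to a hyperedge outside `A` gives a contradiction. -/
theorem edgeConnected_component {H G : Hypergraph (Fin n)} (hGH : G.edgeSet ⊆ H.edgeSet)
    (hne : ∀ e ∈ H.edgeSet, e.Nonempty) (v : Fin n) :
    EdgeConnected verts (edges H) (edges (component G v)) := by
  have hsub : ∀ {f}, f ∈ edges (component G v) → f ∈ edges H := fun hf =>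
    mem_edges.mpr (hGH (mem_edges.mp hf).1)
  have htouch : ∀ {a x : Set (Fin n)} {u : Fin n}, a ∈ edges (component G v) →
      x ∈ edges (component G v) → u ∈ a → u ∈ x → Touch verts (edges H) a x := fun ha hx hua hux =>
    ⟨hsub ha, hsub hx, not_disjoint_iff.mpr ⟨_, mem_verts.mpr hua, mem_verts.mpr hux⟩⟩
  intro A hAU hA hAne
  by_contra hcon
  push Not at hcon
  obtain ⟨a₀, ha₀⟩ := hA
  obtain ⟨x₀, hx₀U, hx₀⟩ := exists_of_ssubset (ssubset_of_subset_of_ne hAU hAne)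
  obtain ⟨u, hu⟩ := hne a₀ (mem_edges.mp (hsub (hAU ha₀)))
  obtain ⟨w, hw⟩ := hne x₀ (mem_edges.mp (hsub hx₀U))
  have hvu : Relation.ReflTransGen G.Adj v u := (mem_edges.mp (hAU ha₀)).2 hu
  have hvw : Relation.ReflTransGen G.Adj v w := (mem_edges.mp hx₀U).2 hw
  have hsymm : Relation.ReflTransGen G.Adj u v := by
    have : Std.Symm G.Adj := ⟨fun _ _ h => Hypergraph.Adj.symm h⟩
    exact Relation.ReflTransGen.stdSymm.symm _ _ hvu
  have hP : ∃ a ∈ A, w ∈ a := by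
    have huw := hsymm.trans hvw
    clear hvw hw
    induction huw with
    | refl => exact ⟨a₀, ha₀, hu⟩
    | tail _ hadj ih =>
      obtain ⟨a, ha, hya⟩ := ih
      obtain ⟨f, hf, hyf, hzf⟩ := hadj
      have hfU : f ∈ edges (component G v) :=
        mem_edges.mpr (component_edge_subset_of_mem hf hyf ((mem_edges.mp (hAU ha)).2 hya))
      refine ⟨f, ?_, hzf⟩
      by_contra hfA
      exact hcon a ha f hfU hfA (htouch (hAU ha) hfU hya hyf)
  obtain ⟨a, ha, hwa⟩ := hP
  exact hcon a ha x₀ hx₀U hx₀ (htouch (hAU ha) hx₀U hwa hw)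

/-- The first step of a walk away from `v` uses a hyperedge at `v`. Thus the union bound needs only
incident pairs. -/
theorem exists_edge_through_root {G : Hypergraph (Fin n)} {v : Fin n} {f : Set (Fin n)}
    (hf : f ∈ (component G v).edgeSet) (hne : f.Nonempty) :
    ∃ e ∈ (component G v).edgeSet, v ∈ e := by
  obtain ⟨w, hw⟩ := hne
  rcases Relation.ReflTransGen.cases_head (hf.2 hw) with rfl | ⟨c, ⟨g, hg, hvg, _⟩, _⟩
  · exact ⟨f, hf, hw⟩
  · exact ⟨g, component_edge_subset_of_mem hg hvg Relation.ReflTransGen.refl, hvg⟩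

/-- In a family of far-apart blocks of a simple hypergraph, every hyperedge keeps many vertices of
`Λ` to itself. -/
theorem exists_private_vertices {H : Hypergraph (Fin n)} {k θ a : ℕ} (hunif : IsUniform H k)
    (hsimple : IsSimple H) (haθ : a + θ = k) {Λ : Finset (Fin n)} (hΛ : Λᶜ.card ≤ 1)
    {𝓕 : Finset (Finset (Set (Fin n)))} (h𝓕 : ∀ B ∈ 𝓕, B ⊆ edges H ∧ B.card = θ)
    (hfar : FarApart verts 𝓕) (e : Set (Fin n)) (he : e ∈ 𝓕.biUnion id) :
    ∃ T ⊆ verts e ∩ Λ, T.card = a ∧ ∀ f ∈ 𝓕.biUnion id, e ≠ f → Disjoint T (verts f) := by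
  obtain ⟨B, hB, heB⟩ := mem_biUnion.mp he
  have heB : e ∈ B := heB
  have heH : e ∈ edges H := (h𝓕 B hB).1 heB
  -- At most one vertex is missing from `Λ`, and each of the other θ - 1 hyperedges of the block
  -- takes at most one: θ in total. Other blocks take none.
  set bad := Λᶜ ∪ (B.erase e).biUnion fun f => verts e ∩ verts f with hbad
  have hbadcard : bad.card ≤ θ := by
    have h1 : ((B.erase e).biUnion fun f => verts e ∩ verts f).card ≤ (B.erase e).card * 1 := by
      refine card_biUnion_le_card_mul _ _ _ fun f hf => ?_
      have hfH : f ∈ edges H := (h𝓕 B hB).1 (mem_of_mem_erase hf)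
      have := hsimple e (mem_edges.mp heH) f (mem_edges.mp hfH) (ne_of_mem_erase hf).symm
      rwa [← coe_verts e, ← coe_verts f, ← coe_inter, Set.ncard_coe_finset] at this
    have h2 : (B.erase e).card + 1 = θ := by rw [card_erase_add_one heB, (h𝓕 B hB).2]
    have h3 : bad.card ≤ Λᶜ.card + ((B.erase e).biUnion fun f => verts e ∩ verts f).card :=
      card_union_le _ _
    omega
  have hge : a ≤ (verts e \ bad).card := by
    have := le_card_sdiff bad (verts e)
    rw [card_verts hunif e heH] at this
    omega
  obtain ⟨T, hT, hTc⟩ := exists_subset_card_eq hge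
  refine ⟨T, fun u hu => ?_, hTc, fun f hf hef => disjoint_left.mpr fun u hu huf => ?_⟩
  · obtain ⟨hue, hub⟩ := mem_sdiff.mp (hT hu)
    refine mem_inter.mpr ⟨hue, ?_⟩
    by_contra hΛu
    exact hub (mem_union_left _ (mem_compl.mpr hΛu))
  · obtain ⟨hue, hub⟩ := mem_sdiff.mp (hT hu)
    obtain ⟨B', hB', hfB'⟩ := mem_biUnion.mp hf
    by_cases hBB : B = B'
    · subst hBB
      exact hub (mem_union_right _ (mem_biUnion.mpr
        ⟨f, mem_erase.mpr ⟨hef.symm, hfB'⟩, mem_inter.mpr ⟨hue, huf⟩⟩))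
    · exact disjoint_left.mp (hfar B hB B' hB' hBB e heB f hfB') hue huf

theorem monoOn_of_not_satisfied {Λ : Finset (Fin n)} {Y : Fin n → Fin s} {e : Set (Fin n)}
    (h : ¬ Satisfied (fun w : Λ => Y w) e) {T : Finset (Fin n)} (hT : T ⊆ verts e ∩ Λ) :
    MonoOn T Y := by
  intro u hu w hw
  by_contra hne
  have hu' := mem_inter.mp (hT hu)
  have hw' := mem_inter.mp (hT hw)
  exact h ⟨⟨u, hu'.2⟩, ⟨w, hw'.2⟩, mem_verts.mp hu'.1, mem_verts.mp hw'.1, hne⟩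

/-- The probability that a hyperedge lies in a large component of the pruned hypergraph. -/
theorem toOuterMeasure_large_component_le {H : Hypergraph (Fin n)} {k θ a : ℕ}
    (hunif : IsUniform H k) (hsimple : IsSimple H) (D : PMF (Fin n → Fin s)) {β : ℝ≥0∞}
    (hD : ∀ (A : Finset (Fin n)) (σ : Fin n → Fin s),
      D.toOuterMeasure {Y | ∀ u ∈ A, Y u = σ u} ≤ β ^ A.card)
    (hΔ : 1 ≤ maxDegree H) (hθ : 1 ≤ θ) (ha : 1 ≤ a) (haθ : a + θ = k)
    {Λ : Finset (Fin n)} (hΛ : Λᶜ.card ≤ 1) (v : Fin n) (e : Set (Fin n)) {L : ℝ} {m : ℕ}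
    (hθL : (θ : ℝ) ≤ L)
    (hm : ((m * (θ * (k * maxDegree H) * (k * θ)) : ℕ) : ℝ) < L) :
    D.toOuterMeasure {Y | e ∈ (component (prune H fun w : Λ => Y w) v).edgeSet ∧
        L ≤ ((component (prune H fun w : Λ => Y w) v).edgeSet.ncard : ℝ)} ≤
      ((4 * (θ * ((k * maxDegree H) * ((k * maxDegree H) * (4 * (k * maxDegree H)) ^ θ)))) ^ (m + 1)
        : ℕ) * (s * β ^ a) ^ ((m + 1) * θ) := by
  have hk1 : 1 ≤ k := by omega
  have hkΔ : 1 ≤ k * maxDegree H := Nat.mul_pos hk1 hΔ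
  have hne : ∀ e ∈ H.edgeSet, e.Nonempty := fun e he => by
    rw [← Set.ncard_pos (Set.toFinite e), hunif e he]
    exact hk1
  -- The witnesses do not depend on `Y`. Being far apart is dropped when they are counted, but is
  -- needed for the private vertices.
  set Fam := univ.filter fun 𝓕 : Finset (Finset (Set (Fin n))) =>
    ((∃ B₀, IsBlock verts (edges H) θ e B₀ ∧
      Grows (fun B B' => B.card = θ ∧ BlockAdj verts (edges H) θ B B') B₀ 𝓕) ∧ 𝓕.card = m + 1) ∧
      (∀ B ∈ 𝓕, B ⊆ edges H ∧ B.card = θ) ∧ FarApart verts 𝓕 with hFam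
  have hFamcard : Fam.card ≤
      (4 * (θ * ((k * maxDegree H) * ((k * maxDegree H) * (4 * (k * maxDegree H)) ^ θ)))) ^ (m + 1) :=
    (card_le_card (monotone_filter_right _ fun 𝓕 _ h => h.1)).trans
      (card_blockFamily_le (card_verts hunif) (card_edges_through_le H) hkΔ hθ e m)
  have hsub : {Y : Fin n → Fin s | e ∈ (component (prune H fun w : Λ => Y w) v).edgeSet ∧
        L ≤ ((component (prune H fun w : Λ => Y w) v).edgeSet.ncard : ℝ)} ⊆
      ⋃ 𝓕 ∈ Fam, {Y | ∀ f ∈ 𝓕.biUnion id, ¬ Satisfied (fun w : Λ => Y w) f} := by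
    rintro Y ⟨heY, hLY⟩
    set G := component (prune H fun w : Λ => Y w) v with hG
    have hcard : G.edgeSet.ncard = (edges G).card := by
      rw [← Set.ncard_coe_finset]
      congr 1
      ext
      simp
    rw [hcard] at hLY
    have hGH : edges G ⊆ edges H := fun f hf => mem_edges.mpr (mem_edges.mp hf).1.1
    obtain ⟨𝓕, hg, hc, h𝓕, hfar⟩ := exists_blockFamily (card_verts hunif) (card_edges_through_le H)
      hk1 hθ hGH (edgeConnected_component (G := prune H fun w : Λ => Y w) (fun f hf => hf.1) hne v)
      (mem_edges.mpr heY) (by exact_mod_cast hθL.trans hLY) m (by exact_mod_cast hm.trans_le hLY)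
    refine Set.mem_iUnion₂.mpr ⟨𝓕, mem_filter.mpr ⟨mem_univ _, ⟨hg, hc⟩,
      fun B hB => ⟨(h𝓕 B hB).1.trans hGH, (h𝓕 B hB).2⟩, hfar⟩, fun f hf => ?_⟩
    obtain ⟨B, hB, hfB⟩ := mem_biUnion.mp hf
    exact (mem_edges.mp ((h𝓕 B hB).1 hfB)).1.2
  calc _ ≤ _ := D.toOuterMeasure.mono hsub
    _ ≤ ∑ 𝓕 ∈ Fam, D.toOuterMeasure {Y | ∀ f ∈ 𝓕.biUnion id, ¬ Satisfied (fun w : Λ => Y w) f} :=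
      MeasureTheory.measure_biUnion_finset_le _ _
    _ ≤ ∑ 𝓕 ∈ Fam, (s * β ^ a) ^ ((m + 1) * θ) := by
      refine sum_le_sum fun 𝓕 hF => ?_
      obtain ⟨⟨_, hc⟩, h𝓕, hfar⟩ := (mem_filter.mp hF).2
      have hW : (𝓕.biUnion id).card = (m + 1) * θ := by
        rw [card_biUnion, sum_congr rfl fun B hB => (show (id B).card = θ from (h𝓕 B hB).2),
          sum_const, hc, smul_eq_mul]
        intro B hB B' hB' hBB
        refine disjoint_left.mpr fun f hf hf' => ?_
        obtain ⟨u, hu⟩ := hne f (mem_edges.mp ((h𝓕 B hB).1 hf))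
        exact disjoint_left.mp (hfar B hB B' hB' hBB f hf f hf') (mem_verts.mpr hu)
          (mem_verts.mpr hu)
      have hT := exists_private_vertices hunif hsimple haθ hΛ h𝓕 hfar
      choose! T hTsub hTcard hTdis using hT
      rw [← hW]
      refine le_trans (D.toOuterMeasure.mono fun Y hY f hf =>
        monoOn_of_not_satisfied (hY f hf) (hTsub f hf))
        (toOuterMeasure_forall_monoOn_le D hD ha T (𝓕.biUnion id) hTcard ?_)
      intro f hf g hg hfg
      exact (hTdis f hf g hg hfg).mono_right ((hTsub g hg).trans inter_subset_left)
    _ ≤ _ := by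
      rw [sum_const, nsmul_eq_mul]
      exact mul_le_mul_left (by exact_mod_cast hFamcard) _

end Components

/-! ### Parameters -/

section Parameters

theorem pow_four_le_four_pow {k : ℕ} (hk : 4 ≤ k) : k ^ 4 ≤ 4 ^ k := by
  induction k, hk using Nat.le_induction with
  | base => norm_num
  | succ k hk ih =>
    have h : (k + 1) ^ 4 ≤ 4 * k ^ 4 := by
      obtain ⟨j, rfl⟩ := Nat.exists_eq_add_of_le hk
      ring_nf
      nlinarith [sq_nonneg j, pow_nonneg (Nat.zero_le j) 3]
    calc (k + 1) ^ 4 ≤ 4 * k ^ 4 := h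
      _ ≤ 4 * 4 ^ k := Nat.mul_le_mul_left _ ih
      _ = 4 ^ (k + 1) := by ring

/-- The block length `⌈4/δ⌉` is less than a fifth of the uniformity. -/
theorem blockLength_bounds {δ : ℝ} {k : ℕ} (hδ : 0 < δ) (hk : 20 * (1 + δ) / δ ≤ (k : ℝ)) :
    1 ≤ ⌈4 / δ⌉₊ ∧ 5 * ⌈4 / δ⌉₊ + 15 ≤ k := by
  have h4 : 0 < 4 / δ := by positivity
  refine ⟨Nat.ceil_pos.mpr h4, ?_⟩
  have hlt := Nat.ceil_lt_add_one h4.le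
  have hk' : 20 * (1 + δ) / δ = 5 * (4 / δ) + 20 := by field_simp; ring
  rw [hk'] at hk
  have : ((5 * ⌈4 / δ⌉₊ + 15 : ℕ) : ℝ) ≤ k := by push_cast; linarith
  exact_mod_cast this

/-- The lower bound on `√q` in terms of an exponent `γ`. -/
theorem exists_exponent {δ : ℝ} {k q Δ : ℕ} (hδ : 0 < δ) (hk : 20 * (1 + δ) / δ ≤ (k : ℝ))
    (hq : 100 * (Δ : ℝ) ^ ((2 + δ) / ((k : ℝ) - 4 / δ - 3)) ≤ (q : ℝ)) :
    ∃ γ : ℝ, 0 ≤ γ ∧ 10 * (Δ : ℝ) ^ γ ≤ Real.sqrt q ∧ 1 ≤ γ * (k - 2 : ℕ) ∧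
      1 + 2 / (⌈4 / δ⌉₊ : ℝ) ≤ γ * (k - ⌈4 / δ⌉₊ - 1 : ℕ) := by
  obtain ⟨hθ1, hθk⟩ := blockLength_bounds hδ hk
  set θ := ⌈4 / δ⌉₊ with hθ
  have h4 : 0 < 4 / δ := by positivity
  have hlt : (θ : ℝ) < 4 / δ + 1 := Nat.ceil_lt_add_one h4.le
  have hge : 4 / δ ≤ (θ : ℝ) := Nat.le_ceil _
  have hk' : 20 * (1 + δ) / δ = 5 * (4 / δ) + 20 := by field_simp; ring
  rw [hk'] at hk
  set d : ℝ := (k : ℝ) - 4 / δ - 3 with hd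
  have hd0 : 0 < d := by linarith
  have hmul : ∀ x : ℝ, d ≤ x → 1 + δ / 2 ≤ (2 + δ) / d / 2 * x := by
    intro x hx
    calc 1 + δ / 2 = (2 + δ) / d / 2 * d := by field_simp
      _ ≤ _ := mul_le_mul_of_nonneg_left hx (by positivity)
  -- Half the exponent of Δ in `hq`, since √q is bounded. Both k - 2 and k - θ - 1 are at least d,
  -- and 2/θ ≤ δ/2.
  refine ⟨(2 + δ) / d / 2, by positivity, ?_, ?_, ?_⟩
  · refine Real.le_sqrt_of_sq_le ?_
    rw [mul_pow, ← Real.rpow_natCast ((Δ : ℝ) ^ _) 2, ← Real.rpow_mul (Nat.cast_nonneg Δ)]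
    norm_num
    exact hq
  · rw [Nat.cast_sub (by omega)]
    push_cast
    have := hmul ((k : ℝ) - 2) (by linarith)
    linarith
  · rw [Nat.sub_sub, Nat.cast_sub (by omega)]
    push_cast
    refine le_trans ?_ (hmul _ (by linarith))
    have hθ0 : (0 : ℝ) < θ := by exact_mod_cast hθ1
    rw [add_le_add_iff_left, div_le_div_iff₀ hθ0 two_pos]
    rw [div_le_iff₀ hδ] at hge
    linarith

/-- The upper bound rests on q ≤ s², whence ⌈q/s⌉ ≤ s. -/
theorem bucket_card_bounds {q : ℕ} (h : ProjectionScheme q ⌈Real.sqrt (q : ℝ)⌉₊)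
    (j : Fin ⌈Real.sqrt (q : ℝ)⌉₊) :
    q / ⌈Real.sqrt (q : ℝ)⌉₊ ≤ (h.bucket j).card ∧
      (h.bucket j).card ≤ ⌈Real.sqrt (q : ℝ)⌉₊ := by
  have hs1 := h.one_le
  have hqs : q ≤ ⌈Real.sqrt (q : ℝ)⌉₊ * ⌈Real.sqrt (q : ℝ)⌉₊ := by
    have h1 := Nat.le_ceil (Real.sqrt (q : ℝ))
    have h2 : (q : ℝ) ≤ (⌈Real.sqrt (q : ℝ)⌉₊ : ℝ) * ⌈Real.sqrt (q : ℝ)⌉₊ := by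
      calc (q : ℝ) = Real.sqrt q * Real.sqrt q := (Real.mul_self_sqrt (Nat.cast_nonneg q)).symm
        _ ≤ _ := mul_le_mul h1 h1 (Real.sqrt_nonneg _) (Nat.cast_nonneg _)
    exact_mod_cast h2
  have hb := h.balanced j
  generalize ⌈Real.sqrt (q : ℝ)⌉₊ = s at *
  have hs : (0 : ℚ) < s := by exact_mod_cast hs1
  have hceil : ⌈(q : ℚ) / s⌉₊ ≤ s := by
    rw [Nat.ceil_le, div_le_iff₀ hs]
    exact_mod_cast hqs
  have hfc : ⌊(q : ℚ) / s⌋₊ ≤ ⌈(q : ℚ) / s⌉₊ := Nat.floor_le_ceil _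
  have hfl : ⌊(q : ℚ) / s⌋₊ = q / s := Nat.floor_div_eq_div q s
  rw [ProjectionScheme.bucket]
  omega

theorem sqrt_bounds {q : ℕ} (hx : 10 ≤ Real.sqrt (q : ℝ)) :
    (⌈Real.sqrt (q : ℝ)⌉₊ : ℝ) ≤ 1.1 * Real.sqrt q ∧
      0.8 * Real.sqrt q ≤ (q / ⌈Real.sqrt (q : ℝ)⌉₊ : ℕ) := by
  have hlt := Nat.ceil_lt_add_one (Real.sqrt_nonneg (q : ℝ))
  have hs : (⌈Real.sqrt (q : ℝ)⌉₊ : ℝ) ≤ 1.1 * Real.sqrt q := by linarith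
  refine ⟨hs, ?_⟩
  have hsq : Real.sqrt q * Real.sqrt q = q := Real.mul_self_sqrt (Nat.cast_nonneg q)
  have hle := Nat.le_ceil (Real.sqrt (q : ℝ))
  set x := Real.sqrt q
  set s := ⌈x⌉₊
  have hs0 : 0 < s := by
    have : (0 : ℝ) < s := by linarith
    exact_mod_cast this
  have h1 : q < s * (q / s + 1) := Nat.lt_mul_div_succ q hs0
  have h2 : (q : ℝ) < s * ((q / s : ℕ) + 1) := by exact_mod_cast h1
  have h3 : (s : ℝ) * ((q / s : ℕ) + 1) ≤ 1.1 * x * ((q / s : ℕ) + 1) :=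
    mul_le_mul_of_nonneg_right hs (by positivity)
  have h4 : x * x < x * (1.1 * ((q / s : ℕ) + 1)) := by linarith
  have h5 := lt_of_mul_lt_mul_left h4 (by linarith)
  linarith

/-- Separates the power of Δ that must be paid for from the numerical surplus c^N, which later
absorbs the factors in k. -/
theorem pow_mul_rpow_le {x D γ y : ℝ} {c : ℝ} (hc : 0 ≤ c) (hD : 1 ≤ D)
    (hx : c * D ^ γ ≤ x) {N : ℕ} (hy : y ≤ γ * N) : c ^ N * D ^ y ≤ x ^ N := by
  have hD0 : 0 ≤ D := by linarith
  calc c ^ N * D ^ y ≤ c ^ N * D ^ (γ * N) :=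
        mul_le_mul_of_nonneg_left (Real.rpow_le_rpow_of_exponent_le hD hy) (by positivity)
    _ = (c * D ^ γ) ^ N := by rw [mul_pow, Real.rpow_mul hD0, Real.rpow_natCast]
    _ ≤ x ^ N := pow_le_pow_left₀ (by positivity) hx N

/-- The local lemma condition, with room to spare. -/
theorem localLemma_condition {b x γ : ℝ} {k Δ : ℕ} (hk : 20 ≤ k) (hΔ : 1 ≤ Δ)
    (hx : 10 * (Δ : ℝ) ^ γ ≤ x) (hb : 0.8 * x ≤ b) (hγ : 1 ≤ γ * (k - 2 : ℕ)) :
    4 * (1 / b ^ (k - 2) * (k * Δ : ℕ)) ≤ 1 ∧ 100 * (2 * (1 / b ^ (k - 2)) * Δ) ≤ 1 := by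
  have hD : (1 : ℝ) ≤ Δ := by exact_mod_cast hΔ
  have h8 : (8 : ℝ) * (Δ : ℝ) ^ γ ≤ b := by linarith
  have hpow := pow_mul_rpow_le (c := 8) (by norm_num) hD h8 hγ
  rw [Real.rpow_one] at hpow
  have hk8 : 200 * k ≤ 8 ^ (k - 2) := by
    obtain ⟨j, rfl⟩ := Nat.exists_eq_add_of_le hk
    clear hγ hpow
    induction j with
    | zero => norm_num
    | succ j ih =>
      have := ih (by omega)
      have e : 8 ^ (20 + (j + 1) - 2) = 8 * 8 ^ (20 + j - 2) := by
        rw [← pow_succ']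
        congr 1
        omega
      rw [e]
      omega
  have hk8' : (200 : ℝ) * k ≤ 8 ^ (k - 2) := by exact_mod_cast hk8
  have hbpos : 0 < b ^ (k - 2) := by
    have : 0 < (8 : ℝ) ^ (k - 2) * Δ := by positivity
    linarith
  have hmain : 200 * (k * Δ : ℝ) ≤ b ^ (k - 2) := by
    have := mul_le_mul_of_nonneg_right hk8' (by linarith : (0 : ℝ) ≤ Δ)
    linarith
  have hkΔ : (Δ : ℝ) ≤ k * Δ := le_mul_of_one_le_left (by linarith) (by exact_mod_cast (by omega))
  push_cast
  constructor
  · rw [one_div, inv_mul_eq_div, ← mul_div_assoc, div_le_one hbpos]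
    nlinarith
  · have : 100 * (2 * (1 / b ^ (k - 2)) * (Δ : ℝ)) = 200 * Δ / b ^ (k - 2) := by ring
    rw [this, div_le_one hbpos]
    linarith

/-- The expected number of extensions of a family by one monochromatic block is at most `2 ^ (-θ)`. -/
theorem block_weight_le {x γ s : ℝ} {k θ Δ : ℕ} (hθ : 1 ≤ θ) (hθk : 5 * θ + 15 ≤ k) (hΔ : 1 ≤ Δ)
    (hx : 10 * (Δ : ℝ) ^ γ ≤ x) (hx10 : 10 ≤ x) (hs0 : 0 ≤ s) (hs : s ≤ 1.1 * x)
    (hγ : 1 + 2 / (θ : ℝ) ≤ γ * (k - θ - 1 : ℕ)) :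
    ((4 * (θ * ((k * Δ) * ((k * Δ) * (4 * (k * Δ)) ^ θ))) : ℕ) : ℝ) *
      (s * (1.12 / x) ^ (k - θ)) ^ θ ≤ (1 / 2) ^ θ := by
  have hD : (1 : ℝ) ≤ Δ := by exact_mod_cast hΔ
  have hD0 : (0 : ℝ) < Δ := by linarith
  have hθ0 : (0 : ℝ) < θ := by exact_mod_cast hθ
  have hx0 : 0 < x := by linarith
  set N := k - θ - 1 with hN
  have hkN : k - θ = N + 1 := by omega
  -- The share of one hyperedge in the entropy of a block: w^θ = Δ^(θ+2).
  set w : ℝ := (Δ : ℝ) ^ (1 + 2 / (θ : ℝ)) with hw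
  have hw0 : 0 < w := Real.rpow_pos_of_pos hD0 _
  have hwθ : w ^ θ = (Δ : ℝ) ^ (θ + 2) := by
    rw [hw, ← Real.rpow_natCast, ← Real.rpow_mul hD0.le, ← Real.rpow_natCast]
    congr 1
    push_cast
    field_simp
  have hxN : (8 : ℝ) ^ N * w ≤ (x / 1.12) ^ N := by
    refine pow_mul_rpow_le (by norm_num) hD ?_ hγ
    rw [le_div_iff₀ (by norm_num)]
    have : 0 ≤ (Δ : ℝ) ^ γ := by positivity
    linarith
  -- With N = k - θ - 1 and k ≥ 5θ + 15 one has 3N ≥ 2k + 6.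
  have h8N : (64 : ℝ) * 4 ^ k ≤ 8 ^ N := by
    have h : 2 ^ (6 + 2 * k) ≤ 2 ^ (3 * N) := Nat.pow_le_pow_right two_pos (by omega)
    rw [pow_add, pow_mul, pow_mul] at h
    norm_num at h
    exact_mod_cast h
  have hedge : s * (1.12 / x) ^ (k - θ) ≤ 1 / (32 * 4 ^ k * w) := by
    have h1 : s * (1.12 / x) ≤ 2 := by
      rw [← mul_div_assoc, div_le_iff₀ hx0]
      linarith
    have h2 : (1.12 / x) ^ N ≤ 1 / (64 * 4 ^ k * w) := by
      have h3 : (64 * 4 ^ k) * w ≤ (x / 1.12) ^ N :=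
        (mul_le_mul_of_nonneg_right h8N hw0.le).trans hxN
      rw [← inv_div, inv_pow, ← one_div]
      exact one_div_le_one_div_of_le (by positivity) h3
    calc s * (1.12 / x) ^ (k - θ) = s * (1.12 / x) * (1.12 / x) ^ N := by rw [hkN, pow_succ]; ring
      _ ≤ 2 * (1 / (64 * 4 ^ k * w)) := mul_le_mul h1 h2 (by positivity) (by norm_num)
      _ = _ := by field_simp; norm_num
  have hk4 : (k : ℝ) ^ 4 ≤ 4 ^ k := by exact_mod_cast pow_four_le_four_pow (by omega : 4 ≤ k)
  have hk0 : (0 : ℝ) < k := by exact_mod_cast (by omega : 0 < k)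
  have hθk' : (θ : ℝ) ≤ k := by exact_mod_cast (by omega : θ ≤ k)
  have hk1 : (1 : ℝ) ≤ k := by exact_mod_cast (by omega : 1 ≤ k)
  push_cast
  calc _ ≤ (4 * (θ * ((k * Δ) * ((k * Δ) * (4 * (k * Δ)) ^ θ))) : ℝ) *
        (1 / (32 * 4 ^ k * w)) ^ θ :=
        mul_le_mul_of_nonneg_left (pow_le_pow_left₀ (by positivity) hedge _) (by positivity)
    _ = 4 * θ * k ^ 2 * (k / (8 * 4 ^ k)) ^ θ := by
        have : (1 / (32 * 4 ^ k * w) : ℝ) ^ θ = 1 / (32 * 4 ^ k) ^ θ / (Δ : ℝ) ^ (θ + 2) := by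
          rw [← hwθ, one_div, inv_pow, mul_pow, mul_inv, one_div, div_eq_mul_inv]
        rw [this]
        have e : (32 * (4 : ℝ) ^ k) ^ θ = 4 ^ θ * (8 * 4 ^ k) ^ θ := by
          rw [← mul_pow]; congr 1; ring
        rw [e, div_pow, mul_pow, mul_pow, pow_add]
        field_simp
    _ ≤ (4 * k ^ 3) ^ θ * (k / (8 * 4 ^ k)) ^ θ := by
        refine mul_le_mul_of_nonneg_right ?_ (by positivity)
        calc (4 * θ * k ^ 2 : ℝ) ≤ 4 * k * k ^ 2 := by gcongr
          _ = 4 * k ^ 3 := by ring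
          _ ≤ (4 * k ^ 3) ^ θ := by
            refine le_self_pow₀ ?_ (by omega)
            have := one_le_pow₀ hk1 (n := 3)
            linarith
    _ = (k ^ 4 / 4 ^ k * (1 / 2)) ^ θ := by
        rw [← mul_pow]; congr 1; field_simp; norm_num
    _ ≤ (1 / 2) ^ θ := by
        refine pow_le_pow_left₀ (by positivity) ?_ _
        have : (k : ℝ) ^ 4 / 4 ^ k ≤ 1 := div_le_one_of_le₀ hk4 (by positivity)
        linarith

/-- Enough blocks make the failure probability as small as required. -/
theorem half_pow_pow_le {θ k M : ℕ} {l : ℝ} (hθ : 1 ≤ θ) (hθk : 5 * θ + 15 ≤ k) (hl : 0 ≤ l)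
    (hM : 4 * k * l / (θ : ℝ) ^ 2 ≤ M) :
    (((1 : ℝ) / 2) ^ θ) ^ M ≤ Real.exp (-l) := by
  have hθ0 : (0 : ℝ) < θ := by exact_mod_cast hθ
  have hhalf : (1 / 2 : ℝ) ≤ Real.exp (-(1 / 2)) := by
    have := Real.one_sub_le_exp_neg (1 / 2 : ℝ)
    linarith
  have hθk' : (θ : ℝ) ≤ k := by exact_mod_cast (by omega : θ ≤ k)
  rw [← pow_mul]
  calc (1 / 2 : ℝ) ^ (θ * M) ≤ Real.exp (-(1 / 2)) ^ (θ * M) :=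
        pow_le_pow_left₀ (by norm_num) hhalf _
    _ = Real.exp ((θ * M : ℕ) * -(1 / 2)) := by rw [Real.exp_nat_mul]
    _ ≤ Real.exp (-l) := by
        refine Real.exp_le_exp.mpr ?_
        push_cast
        rw [div_le_iff₀ (by positivity)] at hM
        have h1 : 4 * θ * l ≤ 4 * k * l := by gcongr
        have h2 : θ * (4 * l) ≤ θ * (M * θ) := by nlinarith
        have h3 := le_of_mul_le_mul_left h2 hθ0
        nlinarith

end Parameters

/-! ### Tail bound along the scan and the union bound. -/

section Main

variable {n : ℕ} {H : Hypergraph (Fin n)} {k q : ℕ} {δ ζ : ℝ}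

theorem one_le_maxDegree {e : Set (Fin n)} (he : e ∈ H.edgeSet) {v : Fin n} (hv : v ∈ e) :
    1 ≤ maxDegree H := by
  refine le_trans ?_ (card_edges_through_le H v)
  exact card_pos.mpr ⟨e, by simpa using ⟨he, hv⟩⟩

theorem ten_le_sqrt {x γ : ℝ} (hγ : 0 ≤ γ) (hΔ : 1 ≤ maxDegree H)
    (hx : 10 * (maxDegree H : ℝ) ^ γ ≤ x) : 10 ≤ x := by
  have := Real.one_le_rpow (x := (maxDegree H : ℝ)) (by exact_mod_cast hΔ) hγ
  linarith

/-- `Sample` fails on component size only if some component meeting `S` is too large. -/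
theorem sample_componentTooLarge_le {s : ℕ} (h : ProjectionScheme q s) (S : Finset (Fin n))
    {Λ : Finset (Fin n)} (Y : Λ → Fin s) (ζ : ℝ) :
    (sample H k h S Y ζ).toOuterMeasure {r | r.1 = SampleExit.componentTooLarge} ≤
      {Y : Λ → Fin s | ∃ v, sizeThreshold n k (maxDegree H) ζ <
        ((component (prune H Y) v).edgeSet.ncard : ℝ)}.indicator 1 Y := by
  rw [sample]
  split_ifs with hex
  · obtain ⟨G, hG, hlt⟩ := hex
    obtain ⟨v, -, rfl⟩ : ∃ v ∈ S, component (prune H Y) v = G := by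
      simpa [componentsMeeting] using hG
    rw [Set.indicator_of_mem (by exact ⟨v, hlt⟩)]
    exact toOuterMeasure_le_one _ _
  · refine le_trans (le_of_eq ?_) zero_le
    rw [PMF.toOuterMeasure_bind_apply, ENNReal.tsum_eq_zero]
    intro r
    rcases r with _ | X
    · rw [PMF.toOuterMeasure_map_apply]
      have : (fun X : S → Fin q => (SampleExit.rejectionFailed, X)) ⁻¹'
          {r | r.1 = SampleExit.componentTooLarge} = ∅ := by
        refine Set.eq_empty_of_forall_notMem fun X hX => ?_
        exact SampleExit.noConfusion hX
      simp [this]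
    · simp [PMF.toOuterMeasure_pure_apply]

variable [NeZero n]

/-- The scan assigns probability at most `(1.12 / √q) ^ |A|` to every configuration of `A`. -/
theorem scan_apply_le (hunif : IsUniform H k) (hδ : 0 < δ) (hk : 20 * (1 + δ) / δ ≤ (k : ℝ))
    (hq : 100 * (maxDegree H : ℝ) ^ ((2 + δ) / ((k : ℝ) - 4 / δ - 3)) ≤ (q : ℝ))
    (h : ProjectionScheme q ⌈Real.sqrt (q : ℝ)⌉₊) (hΔ : 1 ≤ maxDegree H) (ε : ℝ) (t : ℕ)
    (A : Finset (Fin n)) (σ : Fin n → Fin ⌈Real.sqrt (q : ℝ)⌉₊) :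
    (scan H k h ε t).toOuterMeasure {Y | ∀ u ∈ A, Y u = σ u} ≤
      ENNReal.ofReal (1.12 / Real.sqrt q) ^ A.card := by
  obtain ⟨hθ1, hθk⟩ := blockLength_bounds hδ hk
  obtain ⟨γ, hγ0, hx, hγ2, -⟩ := exists_exponent hδ hk hq
  have hx10 := ten_le_sqrt hγ0 hΔ hx
  have hx0 : 0 < Real.sqrt (q : ℝ) := by linarith
  obtain ⟨hs, hb⟩ := sqrt_bounds hx10
  obtain ⟨hLLL, hfac⟩ := localLemma_condition (k := k) (by omega) hΔ hx hb hγ2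
  have hsx := Nat.le_ceil (Real.sqrt (q : ℝ))
  have hb1 : 1 ≤ q / ⌈Real.sqrt (q : ℝ)⌉₊ := by
    have : (1 : ℝ) ≤ (q / ⌈Real.sqrt (q : ℝ)⌉₊ : ℕ) := by linarith
    exact_mod_cast this
  have hsq : Real.sqrt q * Real.sqrt q = q := Real.mul_self_sqrt (Nat.cast_nonneg q)
  refine scan_le H k h ε ?_ ?_ t A σ
  · have h1 := natCast_div_le_ofReal (a := 1) (b := ⌈Real.sqrt (q : ℝ)⌉₊)
      (c := 1.12 / Real.sqrt q) (by positivity) (by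
        rw [div_mul_eq_mul_div, le_div_iff₀ hx0]
        push_cast
        linarith)
    simpa using h1
  · intro v Y ζ j
    refine sample_singleton_le H hunif (by omega) h hb1 (fun j => (bucket_card_bounds h j).1)
      hLLL v Y ζ j (by positivity) ?_
    have hbs : ((h.bucket j).card : ℝ) ≤ 1.1 * Real.sqrt q :=
      le_trans (by exact_mod_cast (bucket_card_bounds h j).2) hs
    -- The choice of 1.12: the unconditioned share is at most 1.1/√q, and 1.1/1.12 < 0.99 ≤ 1 - 2pΔ.
    calc ((h.bucket j).card : ℝ) / q ≤ 1.1 * Real.sqrt q / q := by gcongr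
      _ = 1.1 * Real.sqrt q / (Real.sqrt q * Real.sqrt q) := by rw [hsq]
      _ = 1.12 / Real.sqrt q * (1.1 / 1.12) := by field_simp
      _ ≤ _ := mul_le_mul_of_nonneg_left (by norm_num at hfac ⊢; linarith) (by positivity)

/-- The tail bound for the component of one hyperedge, at any time of the scan. -/
theorem scan_large_component_le (hunif : IsUniform H k) (hsimple : IsSimple H) (hδ : 0 < δ)
    (hk : 20 * (1 + δ) / δ ≤ (k : ℝ))
    (hq : 100 * (maxDegree H : ℝ) ^ ((2 + δ) / ((k : ℝ) - 4 / δ - 3)) ≤ (q : ℝ))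
    (h : ProjectionScheme q ⌈Real.sqrt (q : ℝ)⌉₊) (ε : ℝ) (hζ : ζ ∈ Set.Ioo (0 : ℝ) 1) (t : ℕ)
    {Λ : Finset (Fin n)} (hΛ : Λᶜ.card ≤ 1) (v : Fin n) {e : Set (Fin n)} (he : e ∈ H.edgeSet)
    (hve : v ∈ e) :
    (scan H k h ε t).toOuterMeasure
      {Y | e ∈ (component (prune H fun w : Λ => Y w) v).edgeSet ∧
        sizeThreshold n k (maxDegree H) ζ ≤
          ((component (prune H fun w : Λ => Y w) v).edgeSet.ncard : ℝ)} ≤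
      ENNReal.ofReal (ζ / ((n : ℝ) * (maxDegree H : ℝ))) := by
  have hΔ := one_le_maxDegree he hve
  obtain ⟨hθ1, hθk⟩ := blockLength_bounds hδ hk
  obtain ⟨γ, hγ0, hx, -, hγ⟩ := exists_exponent hδ hk hq
  set θ := ⌈4 / δ⌉₊ with hθ
  have hx10 := ten_le_sqrt hγ0 hΔ hx
  obtain ⟨hs, -⟩ := sqrt_bounds hx10
  set Δ := maxDegree H with hΔdef
  have hD : (1 : ℝ) ≤ Δ := by exact_mod_cast hΔ
  -- A hyperedge exists, so n ≥ k ≥ 20; this makes the logarithm at least 1.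
  have hkn : k ≤ n := by
    rw [← hunif e he]
    simpa using Set.ncard_le_card e
  have hn : (20 : ℝ) ≤ n := by exact_mod_cast (by omega : 20 ≤ n)
  have hk0 : (0 : ℝ) < k := by exact_mod_cast (by omega : 0 < k)
  have hk1 : (1 : ℝ) ≤ k := by exact_mod_cast (by omega : 1 ≤ k)
  have hθ0 : (0 : ℝ) < θ := by exact_mod_cast hθ1
  have hθk' : (θ : ℝ) ≤ k := by exact_mod_cast (by omega : θ ≤ k)
  set l := Real.log ((n : ℝ) * Δ / ζ) with hl
  have hnΔ : (20 : ℝ) ≤ (n : ℝ) * Δ / ζ := by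
    rw [le_div_iff₀ hζ.1]
    nlinarith [hζ.2]
  have hl1 : 1 ≤ l := by
    rw [hl, Real.le_log_iff_exp_le (by linarith)]
    linarith [Real.exp_one_lt_d9]
  have hpos : 0 < 4 * k * l / (θ : ℝ) ^ 2 := by positivity
  -- Here m + 1 = ⌈4kl/θ²⌉. Then mθ²k²Δ lies strictly below the threshold 4Δk³l, as block extraction
  -- requires, while m + 1 blocks suffice for e^(-l).
  obtain ⟨m, hm⟩ := Nat.exists_eq_add_of_le' (Nat.ceil_pos.mpr hpos)
  have hmlt : (m : ℝ) < 4 * k * l / (θ : ℝ) ^ 2 := by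
    have := Nat.ceil_lt_add_one hpos.le
    rw [hm] at this
    push_cast at this
    linarith
  have hmge : 4 * k * l / (θ : ℝ) ^ 2 ≤ ((m + 1 : ℕ) : ℝ) := hm ▸ Nat.le_ceil _
  have hthr : sizeThreshold n k Δ ζ = 4 * Δ * (k : ℝ) ^ 3 * l := rfl
  have hmain := toOuterMeasure_large_component_le (k := k) (θ := θ) (a := k - θ) hunif hsimple
    (scan H k h ε t) (scan_apply_le hunif hδ hk hq h hΔ ε t) hΔ hθ1 (by omega) (by omega) hΛ v e
    (L := sizeThreshold n k Δ ζ) (m := m)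
    (by
      rw [hthr]
      calc (θ : ℝ) ≤ 1 * 1 * k * 1 := by linarith
        _ ≤ 4 * Δ * (k : ℝ) ^ 3 * l := by
          have : (k : ℝ) ≤ k ^ 3 := le_self_pow₀ hk1 (by norm_num)
          gcongr
          norm_num)
    (by
      rw [hthr]
      push_cast
      rw [lt_div_iff₀ (by positivity)] at hmlt
      calc (m : ℝ) * (θ * (k * Δ) * (k * θ)) = m * θ ^ 2 * (k ^ 2 * Δ) := by ring
        _ < 4 * k * l * (k ^ 2 * Δ) := mul_lt_mul_of_pos_right hmlt (by positivity)
        _ = _ := by ring)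
  refine hmain.trans ?_
  rw [← ENNReal.ofReal_natCast, ← ENNReal.ofReal_natCast, ← ENNReal.ofReal_pow (by positivity),
    ← ENNReal.ofReal_mul (by positivity), ← ENNReal.ofReal_pow (by positivity),
    ← ENNReal.ofReal_mul (by positivity)]
  refine ENNReal.ofReal_le_ofReal ?_
  have hw := block_weight_le hθ1 hθk hΔ hx hx10 (Nat.cast_nonneg _) hs hγ
  rw [Nat.cast_pow, mul_comm (m + 1) θ, pow_mul, ← mul_pow]
  calc _ ≤ (((1 : ℝ) / 2) ^ θ) ^ (m + 1) := pow_le_pow_left₀ (by positivity) hw _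
    _ ≤ Real.exp (-l) := half_pow_pow_le hθ1 hθk (by linarith) hmge
    _ = ζ / (n * Δ) := by rw [Real.exp_neg, hl, Real.exp_log (by linarith), inv_div]

theorem card_compl_callDomain_le (T t : ℕ) : ((callDomain n T t)ᶜ).card ≤ 1 := by
  rw [callDomain]
  split_ifs <;> simp

theorem callInput_large_component_le (hunif : IsUniform H k) (hsimple : IsSimple H) (hδ : 0 < δ)
    (hk : 20 * (1 + δ) / δ ≤ (k : ℝ))
    (hq : 100 * (maxDegree H : ℝ) ^ ((2 + δ) / ((k : ℝ) - 4 / δ - 3)) ≤ (q : ℝ))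
    (h : ProjectionScheme q ⌈Real.sqrt (q : ℝ)⌉₊) (ε : ℝ) (hζ : ζ ∈ Set.Ioo (0 : ℝ) 1) (t : ℕ)
    (v : Fin n) {e : Set (Fin n)} (he : e ∈ H.edgeSet) (hve : v ∈ e) :
    (callInput H k h ε t).toOuterMeasure
      {Y | e ∈ (component (prune H Y) v).edgeSet ∧ sizeThreshold n k (maxDegree H) ζ ≤
          ((component (prune H Y) v).edgeSet.ncard : ℝ)} ≤
      ENNReal.ofReal (ζ / ((n : ℝ) * (maxDegree H : ℝ))) := by
  rw [callInput, PMF.toOuterMeasure_map_apply]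
  exact scan_large_component_le hunif hsimple hδ hk hq h ε hζ (t - 1)
    (card_compl_callDomain_le _ t) v he hve

theorem callOutcome_componentTooLarge_le (hunif : IsUniform H k) (hsimple : IsSimple H)
    (hδ : 0 < δ) (hk : 20 * (1 + δ) / δ ≤ (k : ℝ))
    (hq : 100 * (maxDegree H : ℝ) ^ ((2 + δ) / ((k : ℝ) - 4 / δ - 3)) ≤ (q : ℝ))
    (h : ProjectionScheme q ⌈Real.sqrt (q : ℝ)⌉₊) (ε : ℝ) (hζ : ζ ∈ Set.Ioo (0 : ℝ) 1) (t : ℕ) :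
    (callOutcome H k h ε t ζ).toOuterMeasure {r | r.1 = SampleExit.componentTooLarge} ≤
      ENNReal.ofReal ζ := by
  obtain ⟨-, hθk⟩ := blockLength_bounds hδ hk
  have hn : (1 : ℝ) ≤ n := by exact_mod_cast NeZero.one_le
  set Δ := maxDegree H with hΔ
  -- Exceeding a nonnegative threshold forces a hyperedge to exist. For Δ = 0 the threshold is 0.
  have hthr : 0 ≤ sizeThreshold n k Δ ζ := by
    rw [sizeThreshold]
    rcases Nat.eq_zero_or_pos Δ with h0 | h0
    · simp [h0]
    · have hD : (1 : ℝ) ≤ Δ := by exact_mod_cast h0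
      refine mul_nonneg (by positivity) (Real.log_nonneg ?_)
      rw [le_div_iff₀ hζ.1]
      nlinarith [hζ.2]
  have hsub : {Y : callDomain n (numSteps n Δ ε) t → Fin ⌈Real.sqrt (q : ℝ)⌉₊ |
        ∃ v, sizeThreshold n k Δ ζ < ((component (prune H Y) v).edgeSet.ncard : ℝ)} ⊆
      ⋃ v ∈ (univ : Finset (Fin n)), ⋃ e ∈ (edges H).filter fun e => v ∈ verts e,
        {Y | e ∈ (component (prune H Y) v).edgeSet ∧ sizeThreshold n k Δ ζ ≤
          ((component (prune H Y) v).edgeSet.ncard : ℝ)} := by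
    rintro Y ⟨v, hv⟩
    have hcard : 0 < (component (prune H Y) v).edgeSet.ncard := by
      exact_mod_cast hthr.trans_lt hv
    obtain ⟨f, hf⟩ := (Set.ncard_pos (Set.toFinite _)).mp hcard
    have hfne : f.Nonempty := by
      rw [← Set.ncard_pos (Set.toFinite f), hunif f hf.1.1]
      omega
    obtain ⟨e, he, hve⟩ := exists_edge_through_root hf hfne
    simp only [Set.mem_iUnion]
    exact ⟨v, mem_univ v, e, mem_filter.mpr ⟨mem_edges.mpr he.1.1, mem_verts.mpr hve⟩, he, hv.le⟩
  calc _ ≤ (callInput H k h ε t).toOuterMeasure {Y | ∃ v, sizeThreshold n k Δ ζ <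
        ((component (prune H Y) v).edgeSet.ncard : ℝ)} := by
        rw [callOutcome, PMF.toOuterMeasure_bind_apply, PMF.toOuterMeasure_apply]
        refine ENNReal.tsum_le_tsum fun Y => ?_
        refine (mul_le_mul_right (sample_componentTooLarge_le h _ Y ζ) _).trans (le_of_eq ?_)
        by_cases hY : Y ∈ {Y : callDomain n (numSteps n Δ ε) t → Fin ⌈Real.sqrt (q : ℝ)⌉₊ |
            ∃ v, sizeThreshold n k Δ ζ < ((component (prune H Y) v).edgeSet.ncard : ℝ)}
        · rw [Set.indicator_of_mem hY, Set.indicator_of_mem hY, Pi.one_apply, mul_one]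
        · rw [Set.indicator_of_notMem hY, Set.indicator_of_notMem hY, mul_zero]
    _ ≤ _ := PMF.toOuterMeasure _ |>.mono hsub
    _ ≤ ∑ v : Fin n, ∑ e ∈ (edges H).filter fun e => v ∈ verts e,
        (callInput H k h ε t).toOuterMeasure {Y | e ∈ (component (prune H Y) v).edgeSet ∧
          sizeThreshold n k Δ ζ ≤ ((component (prune H Y) v).edgeSet.ncard : ℝ)} :=
        (MeasureTheory.measure_biUnion_finset_le _ _).trans
          (sum_le_sum fun v _ => MeasureTheory.measure_biUnion_finset_le _ _)
    _ ≤ ∑ v : Fin n, ∑ _e ∈ (edges H).filter fun e => v ∈ verts e,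
        ENNReal.ofReal (ζ / ((n : ℝ) * Δ)) := by
        refine sum_le_sum fun v _ => sum_le_sum fun e he => ?_
        obtain ⟨heH, hve⟩ := mem_filter.mp he
        exact callInput_large_component_le hunif hsimple hδ hk hq h ε hζ t v (mem_edges.mp heH)
          (mem_verts.mp hve)
    _ ≤ ∑ _v : Fin n, (Δ : ℝ≥0∞) * ENNReal.ofReal (ζ / ((n : ℝ) * Δ)) := by
        refine sum_le_sum fun v _ => ?_
        rw [sum_const, nsmul_eq_mul]
        exact mul_le_mul_left (by exact_mod_cast card_edges_through_le H v) _
    _ ≤ ENNReal.ofReal ζ := by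
        rw [sum_const, card_univ, Fintype.card_fin, nsmul_eq_mul, ← mul_assoc,
          ← ENNReal.ofReal_natCast, ← ENNReal.ofReal_natCast, ← ENNReal.ofReal_mul (by positivity),
          ← ENNReal.ofReal_mul (by positivity)]
        refine ENNReal.ofReal_le_ofReal ?_
        rcases Nat.eq_zero_or_pos Δ with h0 | h0
        · simp [h0, hζ.1.le]
        · have hD : (0 : ℝ) < Δ := by exact_mod_cast h0
          exact (mul_div_cancel₀ ζ (by positivity : (n : ℝ) * Δ ≠ 0)).le

end Main

end HypergraphColouring

theorem mainTheorem4 {n : ℕ} [NeZero n] (H : Hypergraph (Fin n)) (k q : ℕ) (δ ε ζ : ℝ)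
    (hV : H.vertexSet = Set.univ)
    (hunif : HypergraphColouring.IsUniform H k)
    (hsimple : HypergraphColouring.IsSimple H)
    (hδ : 0 < δ)
    (hk : 20 * (1 + δ) / δ ≤ (k : ℝ))
    (hq : 100 * (HypergraphColouring.maxDegree H : ℝ) ^ ((2 + δ) / ((k : ℝ) - 4 / δ - 3))
      ≤ (q : ℝ))
    (h : HypergraphColouring.ProjectionScheme q ⌈Real.sqrt (q : ℝ)⌉₊)
    (hε : ε ∈ Set.Ioo (0 : ℝ) 1) (hζ : ζ ∈ Set.Ioo (0 : ℝ) 1)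
    (t : ℕ) (ht : 1 ≤ t)
    (htT : t ≤ HypergraphColouring.numSteps n (HypergraphColouring.maxDegree H) ε + 1) :
    (∀ v : Fin n, ∀ e ∈ H.edgeSet, v ∈ e →
      (HypergraphColouring.callInput H k h ε t).toOuterMeasure
          {Y | e ∈ (HypergraphColouring.component (HypergraphColouring.prune H Y) v).edgeSet ∧
            4 * (HypergraphColouring.maxDegree H : ℝ) * (k : ℝ) ^ 3 *
                Real.log ((n : ℝ) * (HypergraphColouring.maxDegree H : ℝ) / ζ) ≤
              ((HypergraphColouring.component (HypergraphColouring.prune H Y) v).edgeSet.ncard : ℝ)}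
        ≤ ENNReal.ofReal (ζ / ((n : ℝ) * (HypergraphColouring.maxDegree H : ℝ)))) ∧
    (HypergraphColouring.callOutcome H k h ε t ζ).toOuterMeasure
        {r | r.1 = HypergraphColouring.SampleExit.componentTooLarge}
      ≤ ENNReal.ofReal ζ := by
  exact ⟨fun v _ he hve => HypergraphColouring.callInput_large_component_le hunif hsimple hδ hk hq h
      ε hζ t v he hve,
    HypergraphColouring.callOutcome_componentTooLarge_le hunif hsimple hδ hk hq h ε hζ t⟩
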